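/- **Lemma 2.5.** Let $k$ be a field of characteristic $0$, let $F=k((t))$ with its $t$-adic topology, and let $\Omega^1_F=F\,dt$ be the $F$-module of (continuous) one-forms, with $df=f'\,dt$. *Flat connections.* A flat connection on $F$ is a finite-dimensional $F$-vector space $E$ with a $k$-linear map $\nabla\colon E\to E\otimes_F\Omega^1_F$ such that $\nabla(fe)=e\otimes df+f\nabla(e)$ for $f\in F$, $e\in E$. With the $F$-linear maps commuting with the connections as morphisms, flat connections form a category $\mathrm{Loc}(F)$; it is an exact category, whose conflations are all short exact sequences. *Calkin objects.* Let $\mathrm{Tate}^{el}(k)$ be the category of elementary Tate spaces over $k$: Hausdorff linearly topologised $k$-vector spaces $V$ ($k$ discrete) having a lattice $L$, i.e. an open linearly compact (pro-finite-dimensional) subspace, with continuous $k$-linear maps. A finite-dimensional $F$-vector space with its $t$-adic topology is such a space. Let $\mathrm{Calk}(k)$ be the idempotent completion of the quotient $\mathrm{Ind}^a(\mathrm{Vect}_f(k))/\mathrm{Vect}_f(k)$ of the category of all $k$-vector spaces by the finite-dimensional ones (its localisation at the linear maps with finite-dimensional kernel and cokernel). It is an exact category: its conflations are the direct summands of images of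 short exact sequences of $k$-vector spaces. There is a natural functor $\mathrm{Tate}^{el}(k)\to\mathrm{Calk}(k)$, $V\mapsto V/L$, where $L$ is a lattice in $V$. *Binary complexes.* A binary complex in an additive category $\mathcal C$ consists of objects $(X^j)_{j\in\mathbb Z}$ and two families of morphisms $d_{1,j},d_{2,j}\colon X^j\to X^{j+1}$ with $d_{i,j+1}d_{i,j}=0$ for $i=1,2$; morphisms are graded and commute with both differentials. If $\mathcal C$ is exact, a complex $(X^\bullet,d)$ is exact if every $d_j$ factors as $X^j\twoheadrightarrow Z^{j+1}\rightarrowtail X^{j+1}$ so that all $Z^j\rightarrowtail X^j\twoheadrightarrow Z^{j+1}$ are conflations; a binary complex is exact if $(X^\bullet,d_1)$ and $(X^\bullet,d_2)$ both are. Let $\mathrm{Bin}_{ex}(\mathcal C)$ be the full subcategory of exact binary complexes in the category $\mathrm{Bin}(\mathcal C)$ of binary complexes, with the degreewise conflations. For $\nu\in\Omega^1_F$ and $(E,\nabla)\in\mathrm{Loc}(F)$ let $\Omega^\bullet_{\nabla,\nu}(E)$ be the binary complex in $\mathrm{Calk}(k)$ which is the image of $$[\,E\rightrightarrows E\otimes_F\Omega^1_F\,],\qquad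 d_1=\nabla,\quad d_2\colon e\mapsto e\otimes\nu,$$ placed in degrees $0$ and $1$; this is functorial in $(E,\nabla)$. **Statement.** Assume $\nu\neq 0$. Then for every flat connection $(E,\nabla)$ on $F$ the binary complex $\Omega^\bullet_{\nabla,\nu}(E)$ is exact in $\mathrm{Calk}(k)$. In particular, $(E,\nabla)\mapsto\Omega^\bullet_{\nabla,\nu}(E)$ defines an exact functor (additive, and mapping conflations to conflations) $$\Omega_{\nabla,\nu}\colon \mathrm{Loc}(F)\to\mathrm{Bin}_{ex}(\mathrm{Calk}(k)).$$ -/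

import Mathlib

open CategoryTheory CategoryTheory.Limits TensorProduct Topology

universe u

namespace EpsilonFactor

section OneForms

variable (k : Type u) [Field k]

/-- The field `k((t))` as a `k`-algebra, with the coefficientwise scalar multiplication. -/
noncomputable instance instAlgebraLaurentSeries : Algebra k (LaurentSeries k) :=
  HahnSeries.instAlgebra

/-- The module `Ω¹_F = F dt` of (continuous) differential one-forms of `F = k((t))`,
free of rank one over `F`.  The one-form `g dt` is represented by its coefficient `g`. -/
def OneForm : Type u := LaurentSeries k

noncomputable instance : AddCommGroup (OneForm k) := inferInstanceAs (AddCommGroup (LaurentSeries k))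

noncomputable instance : Module (LaurentSeries k) (OneForm k) :=
  inferInstanceAs (Module (LaurentSeries k) (LaurentSeries k))

noncomputable instance : Module k (OneForm k) := inferInstanceAs (Module k (LaurentSeries k))

instance : IsScalarTower k (LaurentSeries k) (OneForm k) :=
  inferInstanceAs (IsScalarTower k (LaurentSeries k) (LaurentSeries k))

instance : Module.Finite (LaurentSeries k) (OneForm k) :=
  inferInstanceAs (Module.Finite (LaurentSeries k) (LaurentSeries k))

variable {k}

/-- The one-form `g dt`. -/
def OneForm.mk (g : LaurentSeries k) : OneForm k := g

theorem coeff_derivative (f : LaurentSeries k) (n : ℤ) :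
    (LaurentSeries.derivative k f).coeff n = ((n : k) + 1) * f.coeff (n + 1) := by
  simp [LaurentSeries.hasseDeriv_coeff, add_smul, add_mul]

theorem derivative_mul (f g : LaurentSeries k) :
    LaurentSeries.derivative k (f * g) =
      f * LaurentSeries.derivative k g + g * LaurentSeries.derivative k f := by
  -- the Euler operator `t d/dt`, which does not enlarge supports
  let θ : LaurentSeries k → LaurentSeries k := fun f ↦
    HahnSeries.single 1 1 * LaurentSeries.derivative k f
  have hθ : ∀ (f : LaurentSeries k) (n : ℤ), (θ f).coeff n = n * f.coeff n := by
    intro f n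
    have h := HahnSeries.coeff_single_mul_add (r := (1 : k)) (x := LaurentSeries.derivative k f)
      (a := n - 1) (b := (1 : ℤ))
    rw [sub_add_cancel, coeff_derivative, one_mul, sub_add_cancel] at h
    simp only [θ, h]
    push_cast
    ring
  have hs : ∀ f : LaurentSeries k, (θ f).support ⊆ f.support := by
    intro f n hn h0
    apply hn
    rw [hθ, h0, mul_zero]
  have key : θ (f * g) = f * θ g + g * θ f := by
    ext n
    rw [mul_comm g, hθ, HahnSeries.coeff_add, HahnSeries.coeff_mul,
      HahnSeries.coeff_mul_left' f.isPWO_support (hs f),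
      HahnSeries.coeff_mul_right' g.isPWO_support (hs g), Finset.mul_sum,
      ← Finset.sum_add_distrib]
    refine Finset.sum_congr rfl fun ij hij ↦ ?_
    rw [hθ, hθ]
    have : ij.1 + ij.2 = n := by simpa using (Finset.mem_antidiagonal.1 hij).2.2
    rw [← this]
    push_cast
    ring
  have hne : (HahnSeries.single 1 1 : LaurentSeries k) ≠ 0 := by simp
  apply mul_left_cancel₀ hne
  change θ (f * g) = _
  rw [key]
  simp only [θ]
  ring

/-- The exterior derivative `d : F → Ω¹_F`, `d f = f' dt`. -/
noncomputable def OneForm.d : Derivation k (LaurentSeries k) (OneForm k) :=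
  Derivation.mk' (LaurentSeries.derivative k : LaurentSeries k →ₗ[k] LaurentSeries k)
    fun f g ↦ derivative_mul f g

end OneForms

section TateSpaces

/-- Let `V` be a Hausdorff linearly topologised vector space over the (discrete) field `k`.
`V` is linearly compact, i.e. a pro-finite-dimensional vector space, if its open subspaces have
finite codimension and if it is complete: the injection of `V` into the projective limit of the
quotients `V ⧸ U`, for `U` an open subspace, is onto. -/
structure IsLinearlyCompact (k V : Type*) [Field k] [AddCommGroup V] [Module k V]
    [TopologicalSpace V] : Prop where
  finite_quotient : ∀ U : Submodule k V, IsOpen (U : Set V) → Module.Finite k (V ⧸ U)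
  complete : ∀ a : Submodule k V → V,
    (∀ U U' : Submodule k V, IsOpen (U : Set V) → IsOpen (U' : Set V) → U ≤ U' →
      a U - a U' ∈ U') →
    ∃ x : V, ∀ U : Submodule k V, IsOpen (U : Set V) → x - a U ∈ U

/-- A lattice in a topological vector space: an open linearly compact subspace. -/
structure IsLattice {k V : Type*} [Field k] [AddCommGroup V] [Module k V]
    [TopologicalSpace V] (L : Submodule k V) : Prop where
  isOpen : IsOpen (L : Set V)
  isLinearlyCompact : IsLinearlyCompact k L

/-- Elementary Tate objects over the field `k`: linearly locally compact `k`-vector spaces, that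
is, Hausdorff linearly topologised vector spaces `V` over the discrete field `k` which have a
lattice `L`.  Then `L ↪ V ↠ V ⧸ L` with `L` pro-finite-dimensional and `V ⧸ L` discrete. -/
structure ElTate (k : Type u) [Field k] where
  /-- the underlying vector space -/
  V : Type u
  [addCommGroup : AddCommGroup V]
  [module : Module k V]
  [topologicalSpace : TopologicalSpace V]
  [isTopologicalAddGroup : IsTopologicalAddGroup V]
  [continuousConstSMul : ContinuousConstSMul k V]
  [isLinearTopology : IsLinearTopology k V]
  [t2Space : T2Space V]
  exists_lattice : ∃ L : Submodule k V, IsLattice L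

attribute [instance] ElTate.addCommGroup ElTate.module ElTate.topologicalSpace
  ElTate.isTopologicalAddGroup ElTate.continuousConstSMul ElTate.isLinearTopology ElTate.t2Space

namespace ElTate

variable {k : Type u} [Field k]

/-- Morphisms of Tate spaces are the continuous linear maps. -/
noncomputable instance : Category (ElTate k) where
  Hom V W := V.V →L[k] W.V
  id V := ContinuousLinearMap.id k V.V
  comp f g := ContinuousLinearMap.comp g f

/-- The continuous linear map underlying a morphism of Tate spaces. -/
def Hom.toCLM {V W : ElTate k} (f : V ⟶ W) : V.V →L[k] W.V := f

noncomputable instance : Preadditive (ElTate k) where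
  homGroup V W := inferInstanceAs (AddCommGroup (V.V →L[k] W.V))
  add_comp _ _ _ f f' g := ContinuousLinearMap.comp_add g f f'
  comp_add _ _ _ f g g' := ContinuousLinearMap.add_comp g g' f

/-- A chosen lattice of a Tate space. -/
noncomputable def lattice (V : ElTate k) : Submodule k V.V := V.exists_lattice.choose

theorem lattice_spec (V : ElTate k) : IsLattice V.lattice := V.exists_lattice.choose_spec

/-- The zero Tate space. -/
def zero (k : Type u) [Field k] : ElTate k where
  V := PUnit.{u + 1}
  exists_lattice := ⟨⊤, isOpen_discrete _,
    ⟨fun _ _ ↦ inferInstance, fun _ _ ↦ ⟨0, fun U _ ↦ by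
      convert! U.zero_mem⟩⟩⟩

end ElTate

end TateSpaces

section LaurentTopology

variable (k : Type u) [Field k]

/-- `t^n k[[t]]`, as a `k`-subspace of `k((t))`. -/
def fracIdeal (n : ℤ) : Submodule k (LaurentSeries k) where
  carrier := {f | ∀ j < n, f.coeff j = 0}
  add_mem' hf hg j hj := by simp [hf j hj, hg j hj]
  zero_mem' := by simp
  smul_mem' c f hf j hj := by simp [hf j hj]

open WithZero in
theorem hasBasis_fracIdeal : (𝓝 (0 : LaurentSeries k)).HasBasis (fun _ : ℤ ↦ True)
    (fun n ↦ (fracIdeal k n : Set (LaurentSeries k))) := by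
  have hval : ∀ n : ℤ, (fracIdeal k n : Set (LaurentSeries k)) =
      {f | Valued.v f ≤ exp (-n)} := by
    intro n
    ext f
    exact (LaurentSeries.valuation_le_iff_coeff_lt_eq_zero k).symm
  refine Filter.hasBasis_iff.2 fun s ↦ ⟨fun hs ↦ ?_, ?_⟩
  · obtain ⟨γ, hγ⟩ := Valued.mem_nhds_zero.1 hs
    simp_rw [Valued.v.restrict_lt_iff_lt_embedding] at hγ
    refine ⟨-(log (MonoidWithZeroHom.ValueGroup₀.embedding γ.1) - 1), trivial, ?_⟩
    rw [hval]
    refine fun f hf ↦ hγ (show Valued.v f < _ from lt_of_le_of_lt hf ?_)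
    rw [← lt_log_iff_exp_lt (by simp)]
    simp
  · rintro ⟨n, -, hn⟩
    refine Filter.mem_of_superset ?_ hn
    rw [Valued.mem_nhds_zero]
    have hx : Valued.v.restrict (HahnSeries.single n (1 : k)) ≠ 0 := by simp
    refine ⟨Units.mk0 _ hx, ?_⟩
    rw [hval]
    intro f hf
    have hf' : Valued.v.restrict f < Valued.v.restrict (HahnSeries.single n (1 : k)) := hf
    rw [Valuation.restrict_lt_iff, LaurentSeries.valuation_single_zpow] at hf'
    exact hf'.le

theorem continuous_derivative : Continuous (LaurentSeries.derivative k :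
    LaurentSeries k →ₗ[k] LaurentSeries k) := by
  refine continuous_of_continuousAt_zero _ ?_
  rw [ContinuousAt, map_zero]
  refine ((hasBasis_fracIdeal k).tendsto_iff (hasBasis_fracIdeal k)).2 fun n _ ↦
    ⟨n + 1, trivial, fun f hf j hj ↦ ?_⟩
  rw [coeff_derivative, hf _ (by lia), mul_zero]

end LaurentTopology

section FiniteDimensional

variable {k : Type u} [Field k] {E : Type u} [AddCommGroup E] [Module (LaurentSeries k) E]
  [Module k E] [IsScalarTower k (LaurentSeries k) E]

/-- The subspace `⨁ i, t^n k[[t]] b_i` of a vector space over `k((t))` with basis `b`. -/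
noncomputable def stdLattice {m : ℕ} (b : Module.Basis (Fin m) (LaurentSeries k) E) (n : ℤ) :
    Submodule k E where
  carrier := {x | ∀ i, b.repr x i ∈ fracIdeal k n}
  add_mem' hx hy i := by
    rw [map_add]
    exact add_mem (hx i) (hy i)
  zero_mem' i := by
    rw [map_zero]
    exact zero_mem _
  smul_mem' c x hx i := by
    rw [← algebraMap_smul (LaurentSeries k) c x, map_smul, Finsupp.smul_apply, algebraMap_smul]
    exact Submodule.smul_mem _ _ (hx i)

theorem stdLattice_mono {m : ℕ} (b : Module.Basis (Fin m) (LaurentSeries k) E) {n n' : ℤ}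
    (h : n ≤ n') : stdLattice b n' ≤ stdLattice b n :=
  fun _ hx i j hj ↦ hx i j (hj.trans_le h)

variable [TopologicalSpace E] [IsModuleTopology (LaurentSeries k) E]

theorem hasBasis_stdLattice {m : ℕ} (b : Module.Basis (Fin m) (LaurentSeries k) E) :
    (𝓝 (0 : E)).HasBasis (fun _ : ℤ ↦ True) (fun n ↦ (stdLattice b n : Set E)) := by
  have : ContinuousAdd E := IsModuleTopology.toContinuousAdd (LaurentSeries k) E
  have h1 : Continuous b.equivFun := IsModuleTopology.continuous_of_linearMap b.equivFun.toLinearMap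
  have h2 : Continuous b.equivFun.symm :=
    IsModuleTopology.continuous_of_linearMap b.equivFun.symm.toLinearMap
  let e : E ≃ₜ (Fin m → LaurentSeries k) :=
    { b.equivFun.toEquiv with
      continuous_toFun := h1
      continuous_invFun := h2 }
  have he : 𝓝 (0 : E) = Filter.comap e (𝓝 0) := by
    rw [e.isInducing.nhds_eq_comap]
    exact congrArg (fun z ↦ Filter.comap e (𝓝 z)) b.equivFun.map_zero
  rw [he, nhds_pi]
  have hb := Filter.hasBasis_pi (fun _ : Fin m ↦ hasBasis_fracIdeal k)
  refine Filter.hasBasis_iff.2 fun s ↦ ?_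
  have hb' := (hb.comap e).mem_iff (t := s)
  refine Iff.trans hb' ⟨?_, ?_⟩
  · rintro ⟨⟨I, f⟩, -, hs⟩
    obtain ⟨N, hN⟩ : ∃ N, ∀ i, f i ≤ N :=
      ⟨∑ i, |f i|, fun i ↦ (le_abs_self _).trans
        (Finset.single_le_sum (f := fun i ↦ |f i|) (fun _ _ ↦ abs_nonneg _) (Finset.mem_univ i))⟩
    exact ⟨N, trivial, fun x hx ↦ hs fun i _ j hj ↦ hx i j (hj.trans_le (hN i))⟩
  · rintro ⟨n, -, hs⟩
    exact ⟨⟨Set.univ, fun _ ↦ n⟩, ⟨Set.finite_univ, fun _ _ ↦ trivial⟩,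
      fun x hx ↦ hs fun i ↦ hx i trivial⟩

theorem stdLattice_isOpen {m : ℕ} (b : Module.Basis (Fin m) (LaurentSeries k) E) (n : ℤ) :
    IsOpen (stdLattice b n : Set E) := by
  have : IsTopologicalAddGroup E := IsModuleTopology.topologicalAddGroup (LaurentSeries k) E
  exact (stdLattice b n).toAddSubgroup.isOpen_of_mem_nhds
    ((hasBasis_stdLattice b).mem_of_mem trivial)

theorem stdLattice_isLattice {m : ℕ} (b : Module.Basis (Fin m) (LaurentSeries k) E) :
    IsLattice (stdLattice b 0) := by
  have : IsTopologicalAddGroup E := IsModuleTopology.topologicalAddGroup (LaurentSeries k) E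
  have hex : ∀ U : Submodule k (stdLattice b 0), IsOpen (U : Set (stdLattice b 0)) →
      ∃ n : ℕ, ∀ x : stdLattice b 0, (x : E) ∈ stdLattice b n → x ∈ U := by
    intro U hU
    have h0 : (U : Set (stdLattice b 0)) ∈ 𝓝 0 := hU.mem_nhds U.zero_mem
    rw [nhds_subtype_eq_comap] at h0
    obtain ⟨n, -, hn⟩ := ((hasBasis_stdLattice b).comap _).mem_iff.1 h0
    exact ⟨n.toNat, fun x hx ↦ hn (stdLattice_mono b (Int.self_le_toNat n) hx)⟩
  refine ⟨stdLattice_isOpen b 0, ⟨fun U hU ↦ ?_, fun a ha ↦ ?_⟩⟩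
  · obtain ⟨n, hn⟩ := hex U hU
    let φ : stdLattice b 0 →ₗ[k] (Fin m → Fin n → k) :=
      { toFun := fun x i j ↦ (b.repr (x : E) i).coeff (j : ℕ)
        map_add' := fun x y ↦ by
          ext i j
          simp
        map_smul' := fun c x ↦ by
          ext i j
          rw [Submodule.coe_smul, ← algebraMap_smul (LaurentSeries k) c (x : E), map_smul,
            Finsupp.smul_apply, algebraMap_smul]
          simp }
    have hφ : LinearMap.ker φ ≤ U := by
      intro x hx
      refine hn x fun i j hj ↦ ?_
      by_cases h0 : j < 0
      · exact x.2 i j h0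
      · have := congrFun (congrFun (LinearMap.mem_ker.1 hx) i) ⟨j.toNat, by lia⟩
        simpa [φ, Int.toNat_of_nonneg (not_lt.1 h0)] using this
    have hfin : Module.Finite k (stdLattice b 0 ⧸ LinearMap.ker φ) :=
      Module.Finite.equiv φ.quotKerEquivRange.symm
    exact Module.Finite.of_surjective (Submodule.factor hφ) (Submodule.factor_surjective hφ)
  · let S : ℕ → Submodule k (stdLattice b 0) := fun n ↦ (stdLattice b n).comap (Submodule.subtype _)
    have hS : ∀ n, IsOpen (S n : Set (stdLattice b 0)) := fun n ↦
      (stdLattice_isOpen b n).preimage continuous_subtype_val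
    have hSm : ∀ n n', n ≤ n' → S n' ≤ S n := fun n n' h x hx ↦
      stdLattice_mono b (by exact_mod_cast h) hx
    -- the limit, coefficient by coefficient
    let c : Fin m → ℕ → k := fun i j ↦ (b.repr (a (S (j + 1)) : E) i).coeff j
    let y : Fin m → LaurentSeries k := fun i ↦ HahnSeries.ofPowerSeries ℤ k (PowerSeries.mk (c i))
    let x : E := b.equivFun.symm y
    have hxi : ∀ i, b.repr x i = y i := fun i ↦ by
      rw [← b.equivFun_apply, b.equivFun.apply_symm_apply]
    have hx0 : x ∈ stdLattice b 0 := by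
      intro i j hj
      rw [hxi]
      have : ((y i).coeff j) = 0 := by
        simp only [y, HahnSeries.ofPowerSeries_apply]
        apply HahnSeries.embDomain_of_notMem_range
        rintro ⟨n, hn⟩
        have : (n : ℤ) = j := hn
        lia
      exact this
    have hxS : ∀ n, (⟨x, hx0⟩ : stdLattice b 0) - a (S n) ∈ S n := by
      intro n i j hj
      by_cases h0 : j < 0
      · exact (⟨x, hx0⟩ - a (S n) : stdLattice b 0).2 i j h0
      · lift j to ℕ using not_lt.1 h0
        have h1 := ha (S n) (S (j + 1)) (hS _) (hS _) (hSm _ _ (by lia))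
        have h2 := h1 i j (by lia)
        simp only [Submodule.subtype_apply, map_sub, Finsupp.sub_apply,
          HahnSeries.coeff_sub] at h2 ⊢
        rw [sub_eq_zero] at h2 ⊢
        rw [h2, hxi]
        simp [y, c, HahnSeries.ofPowerSeries_apply_coeff]
    refine ⟨⟨x, hx0⟩, fun U hU ↦ ?_⟩
    obtain ⟨n, hn⟩ := hex U hU
    have hSU : S n ≤ U := fun z hz ↦ hn z hz
    have := U.add_mem (hSU (hxS n)) (ha (S n) U (hS n) hU hSU)
    simpa using this

end FiniteDimensional

section TateOfFinite

variable {k : Type u} [Field k]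

/-- A finite-dimensional vector space `E` over `k((t))`, with its `t`-adic topology (the module
topology, i.e. the product topology of `k((t))^m` for any choice of a basis), is a Tate space. -/
noncomputable def ElTate.ofFinite (E : Type u) [AddCommGroup E] [Module (LaurentSeries k) E]
    [Module k E] [IsScalarTower k (LaurentSeries k) E] [Module.Finite (LaurentSeries k) E] :
    ElTate k :=
  letI : TopologicalSpace E := moduleTopology (LaurentSeries k) E
  have : IsModuleTopology (LaurentSeries k) E := ⟨rfl⟩
  have : IsTopologicalAddGroup E := IsModuleTopology.topologicalAddGroup (LaurentSeries k) E
  have hc : ContinuousConstSMul k E := ⟨fun c ↦ by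
    simpa only [algebraMap_smul] using
      continuous_const_smul (T := E) (algebraMap k (LaurentSeries k) c)⟩
  let b := Module.finBasis (LaurentSeries k) E
  have hl : IsLinearTopology k E := IsLinearTopology.mk_of_hasBasis k (hasBasis_stdLattice b)
  have ht : T2Space E := by
    have : T2Space (Fin (Module.finrank (LaurentSeries k) E) → LaurentSeries k) := inferInstance
    exact T2Space.of_injective_continuous b.equivFun.injective
      (IsModuleTopology.continuous_of_linearMap b.equivFun.toLinearMap)
  { V := E
    exists_lattice := ⟨stdLattice b 0, stdLattice_isLattice b⟩ }

end TateOfFinite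

section Exact

variable {C : Type*} [Category C] [HasZeroMorphisms C]

/-- A complex `(X, d)` is acyclic (or exact), relative to the class `𝓔` of conflations
(= short exact sequences of an exact category), if every differential factors as
`X j ↠ Z (j + 1) ↣ X (j + 1)` in such a way that each `Z j ↣ X j ↠ Z (j + 1)` is a conflation. -/
def IsAcyclic (𝓔 : ObjectProperty (ShortComplex C)) (X : ℤ → C) (d : ∀ j, X j ⟶ X (j + 1)) :
    Prop :=
  ∃ (Z : ℤ → C) (i : ∀ j, Z j ⟶ X j) (p : ∀ j, X j ⟶ Z (j + 1)) (w : ∀ j, i j ≫ p j = 0),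
    (∀ j, p j ≫ i (j + 1) = d j) ∧ ∀ j, 𝓔 (ShortComplex.mk (i j) (p j) (w j))

/-- An exact functor between exact categories, given with their classes of conflations: an
additive functor which maps conflations to conflations. -/
structure IsExactFunctor {A B : Type*} [Category A] [Preadditive A] [Category B] [Preadditive B]
    (𝓐 : ObjectProperty (ShortComplex A)) (𝓑 : ObjectProperty (ShortComplex B)) (F : A ⥤ B) :
    Prop where
  additive : F.Additive
  map_conflation : ∀ S : ShortComplex A, 𝓐 S → 𝓑 (S.map F)

end Exact

/-- A binary complex: a `ℤ`-graded object with two differentials of degree one. -/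
structure BinaryComplex (C : Type*) [Category C] [HasZeroMorphisms C] where
  X : ℤ → C
  d₁ : ∀ j, X j ⟶ X (j + 1)
  d₂ : ∀ j, X j ⟶ X (j + 1)
  d₁_comp : ∀ j, d₁ j ≫ d₁ (j + 1) = 0
  d₂_comp : ∀ j, d₂ j ≫ d₂ (j + 1) = 0

namespace BinaryComplex

section Basic

variable {C : Type*} [Category C] [HasZeroMorphisms C]

/-- Morphisms of binary complexes commute with both differentials. -/
@[ext]
structure Hom (K L : BinaryComplex C) where
  f : ∀ j, K.X j ⟶ L.X j
  comm₁ : ∀ j, K.d₁ j ≫ f (j + 1) = f j ≫ L.d₁ j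
  comm₂ : ∀ j, K.d₂ j ≫ f (j + 1) = f j ≫ L.d₂ j

instance : Category (BinaryComplex C) where
  Hom := Hom
  id K := ⟨fun j ↦ 𝟙 _, by simp, by simp⟩
  comp φ ψ := ⟨fun j ↦ φ.f j ≫ ψ.f j,
    fun j ↦ by rw [← Category.assoc, φ.comm₁, Category.assoc, ψ.comm₁, Category.assoc],
    fun j ↦ by rw [← Category.assoc, φ.comm₂, Category.assoc, ψ.comm₂, Category.assoc]⟩

@[ext]
theorem hom_ext {K L : BinaryComplex C} {φ ψ : K ⟶ L} (h : ∀ j, φ.f j = ψ.f j) : φ = ψ :=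
  Hom.ext (funext h)

@[simp]
theorem id_f (K : BinaryComplex C) (j : ℤ) : Hom.f (𝟙 K) j = 𝟙 (K.X j) := rfl

@[simp]
theorem comp_f {K L M : BinaryComplex C} (φ : K ⟶ L) (ψ : L ⟶ M) (j : ℤ) :
    (φ ≫ ψ).f j = φ.f j ≫ ψ.f j := rfl

/-- A binary complex is exact if both of its differentials define an exact complex. -/
def IsExact (𝓔 : ObjectProperty (ShortComplex C)) (K : BinaryComplex C) : Prop :=
  IsAcyclic 𝓔 K.X K.d₁ ∧ IsAcyclic 𝓔 K.X K.d₂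

/-- The functor on binary complexes induced by a functor. -/
@[simps]
def mapFunctor {D : Type*} [Category D] [HasZeroMorphisms D] (F : C ⥤ D)
    [F.PreservesZeroMorphisms] : BinaryComplex C ⥤ BinaryComplex D where
  obj K :=
    { X := fun j ↦ F.obj (K.X j)
      d₁ := fun j ↦ F.map (K.d₁ j)
      d₂ := fun j ↦ F.map (K.d₂ j)
      d₁_comp := fun j ↦ by rw [← F.map_comp, K.d₁_comp, F.map_zero]
      d₂_comp := fun j ↦ by rw [← F.map_comp, K.d₂_comp, F.map_zero] }
  map φ :=
    { f := fun j ↦ F.map (φ.f j)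
      comm₁ := fun j ↦ by rw [← F.map_comp, φ.comm₁, F.map_comp]
      comm₂ := fun j ↦ by rw [← F.map_comp, φ.comm₂, F.map_comp] }

/-- The terms of the complex `⋯ → Z → X → Y → Z → ⋯`, with `X` in degree `0` and `Y` in
degree `1` (used with a zero object `Z`). -/
def twoTermX (Z X Y : C) : ℤ → C
  | .ofNat 0 => X
  | .ofNat 1 => Y
  | .ofNat (_ + 2) => Z
  | .negSucc _ => Z

/-- The differential of the two-term complex with given differential in degree `0`. -/
def twoTermD (Z : C) {X Y : C} (f : X ⟶ Y) (j : ℤ) : twoTermX Z X Y j ⟶ twoTermX Z X Y (j + 1) :=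
  match j with
  | .ofNat 0 => f
  | .ofNat (_ + 1) => 0
  | .negSucc _ => 0

theorem twoTermD_of_ne (Z : C) {X Y : C} (f : X ⟶ Y) (j : ℤ) (hj : j ≠ 0) :
    twoTermD Z f j = 0 := by
  match j, hj with
  | .ofNat 0, hj => exact absurd rfl hj
  | .ofNat (_ + 1), _ => rfl
  | .negSucc _, _ => rfl

theorem twoTermD_comp (Z : C) {X Y : C} (f : X ⟶ Y) (j : ℤ) :
    twoTermD Z f j ≫ twoTermD Z f (j + 1) = 0 := by
  by_cases hj : j = 0
  · subst hj
    exact comp_zero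
  · rw [twoTermD_of_ne Z f j hj, zero_comp]

/-- The two-term binary complex `X ⇉ Y`, placed in degrees `0` and `1`, with a zero object `Z` in
all other degrees. -/
def twoTerm (Z : C) {X Y : C} (f g : X ⟶ Y) : BinaryComplex C where
  X := twoTermX Z X Y
  d₁ := twoTermD Z f
  d₂ := twoTermD Z g
  d₁_comp := twoTermD_comp Z f
  d₂_comp := twoTermD_comp Z g

/-- The components of a morphism of two-term complexes. -/
def twoTermHom (Z : C) {X Y X' Y' : C} (a : X ⟶ X') (b : Y ⟶ Y') (j : ℤ) :
    twoTermX Z X Y j ⟶ twoTermX Z X' Y' j :=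
  match j with
  | .ofNat 0 => a
  | .ofNat 1 => b
  | .ofNat (_ + 2) => 𝟙 Z
  | .negSucc _ => 𝟙 Z

theorem twoTermHom_comm (Z : C) {X Y X' Y' : C} {f : X ⟶ Y} {f' : X' ⟶ Y'} {a : X ⟶ X'}
    {b : Y ⟶ Y'} (h : f ≫ b = a ≫ f') (j : ℤ) :
    twoTermD Z f j ≫ twoTermHom Z a b (j + 1) = twoTermHom Z a b j ≫ twoTermD Z f' j := by
  by_cases hj : j = 0
  · subst hj
    exact h
  · rw [twoTermD_of_ne Z f j hj, twoTermD_of_ne Z f' j hj, zero_comp, comp_zero]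

/-- A morphism of two-term binary complexes. -/
def twoTermMap (Z : C) {X Y X' Y' : C} {f g : X ⟶ Y} {f' g' : X' ⟶ Y'} (a : X ⟶ X') (b : Y ⟶ Y')
    (hf : f ≫ b = a ≫ f') (hg : g ≫ b = a ≫ g') : twoTerm Z f g ⟶ twoTerm Z f' g' where
  f := twoTermHom Z a b
  comm₁ := twoTermHom_comm Z hf
  comm₂ := twoTermHom_comm Z hg

end Basic

section Preadditive

variable {C : Type*} [Category C] [Preadditive C] (K L : BinaryComplex C)

instance : Zero (K ⟶ L) := ⟨⟨fun _ ↦ 0, by simp, by simp⟩⟩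

instance : Add (K ⟶ L) := ⟨fun φ ψ ↦ ⟨fun j ↦ φ.f j + ψ.f j,
  by simp [φ.comm₁, ψ.comm₁], by simp [φ.comm₂, ψ.comm₂]⟩⟩

instance : Neg (K ⟶ L) := ⟨fun φ ↦ ⟨fun j ↦ - φ.f j, by simp [φ.comm₁], by simp [φ.comm₂]⟩⟩

@[simp] theorem zero_f (j : ℤ) : Hom.f (0 : K ⟶ L) j = 0 := rfl

variable {K L}

@[simp] theorem add_f (φ ψ : K ⟶ L) (j : ℤ) : (φ + ψ).f j = φ.f j + ψ.f j := rfl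

@[simp] theorem neg_f (φ : K ⟶ L) (j : ℤ) : (-φ).f j = - φ.f j := rfl

instance : Preadditive (BinaryComplex C) where
  homGroup K L :=
    { add_assoc := fun _ _ _ ↦ by ext; simp [add_assoc]
      zero_add := fun _ ↦ by ext; simp
      add_zero := fun _ ↦ by ext; simp
      neg_add_cancel := fun _ ↦ by ext; simp
      add_comm := fun _ _ ↦ by ext; simp [add_comm]
      nsmul := nsmulRec
      zsmul := zsmulRec }
  add_comp _ _ _ _ _ _ := by ext; simp
  comp_add _ _ _ _ _ _ := by ext; simp

/-- The degree `j` part of a binary complex. -/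
@[simps]
def eval (j : ℤ) : BinaryComplex C ⥤ C where
  obj K := K.X j
  map φ := φ.f j

instance (j : ℤ) : (eval (C := C) j).Additive where

end Preadditive

end BinaryComplex

section BinEx

variable {C : Type*} [Category C] [Preadditive C]

/-- The full subcategory of exact binary complexes. -/
abbrev BinEx (𝓔 : ObjectProperty (ShortComplex C)) :=
  ObjectProperty.FullSubcategory fun K : BinaryComplex C ↦ K.IsExact 𝓔

/-- The inclusion of the exact binary complexes in all binary complexes. -/
abbrev BinEx.ι (𝓔 : ObjectProperty (ShortComplex C)) : BinEx 𝓔 ⥤ BinaryComplex C :=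
  ObjectProperty.ι _

/-- The conflations of binary complexes are the degreewise conflations. -/
def BinEx.conflations (𝓔 : ObjectProperty (ShortComplex C)) :
    ObjectProperty (ShortComplex (BinEx 𝓔)) :=
  fun S ↦ ∀ j : ℤ, 𝓔 ((S.map (BinEx.ι 𝓔)).map (BinaryComplex.eval j))

end BinEx

section Calkin

variable (k : Type u) [Field k]

instance isSerreClass_isFG : (ModuleCat.isFG.{u} k).IsSerreClass where
  exists_zero := ⟨.of k PUnit, ModuleCat.isZero_of_subsingleton _, by
    rw [ModuleCat.isFG_iff]
    infer_instance⟩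
  prop_of_mono {M N} f hf hN := by
    rw [ModuleCat.mono_iff_injective] at hf
    rw [ModuleCat.isFG_iff] at hN ⊢
    exact Module.Finite.of_injective f.hom hf
  prop_of_epi {M N} f hf hM := by
    rw [ModuleCat.epi_iff_surjective] at hf
    rw [ModuleCat.isFG_iff] at hM ⊢
    exact Module.Finite.of_surjective f.hom hf
  prop_X₂_of_shortExact {S} hS h₁ h₃ := by
    rw [ModuleCat.isFG_iff] at h₁ h₃ ⊢
    have hex : Function.Exact S.f.hom S.g.hom :=
      (ShortComplex.ShortExact.moduleCat_exact_iff_function_exact S).1 hS.exact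
    have := hS.epi_g
    exact Module.Finite.of_exact hex ((ModuleCat.epi_iff_surjective S.g).1 this)

/-- The quotient category `Ind^a(C) / C` for `C` the category of finite-dimensional `k`-vector
spaces.  Admissible Ind-objects of `C` are the same as arbitrary `k`-vector spaces, and the
quotient is the localisation at the morphisms with finite-dimensional kernel and cokernel. -/
abbrev IndQuotient : Type (u + 1) := (ModuleCat.isFG.{u} k).isoModSerre.Localization

/-- The localisation functor `Ind^a(C) ⥤ Ind^a(C) / C`. -/
noncomputable abbrev IndQuotient.Q : ModuleCat.{u} k ⥤ IndQuotient k :=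
  (ModuleCat.isFG.{u} k).isoModSerre.Q

/-- The category of Calkin objects over `k`: the idempotent completion of `Ind^a(C) / C`. -/
abbrev Calk : Type (u + 1) := Idempotents.Karoubi (IndQuotient k)

/-- The conflations of the exact category `Calk(k)`: the direct summands of images of short exact
sequences of `Ind^a(C)`. -/
def Calk.conflations : ObjectProperty (ShortComplex (Calk k)) := fun S ↦
  ∃ T : ShortComplex (ModuleCat.{u} k), T.ShortExact ∧
    Nonempty (Retract S (T.map (IndQuotient.Q k ⋙ Idempotents.toKaroubi (IndQuotient k))))

variable {k}

theorem finite_range_comp_subtype {V W : Type u} [AddCommGroup V] [Module k V] [TopologicalSpace V]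
    [AddCommGroup W] [Module k W] [TopologicalSpace W] [IsTopologicalAddGroup W]
    (f : V →L[k] W) {L : Submodule k V} (hL : IsLattice L) {M : Submodule k W}
    (hM : IsOpen (M : Set W)) :
    Module.Finite k (L.map (M.mkQ ∘ₗ (f : V →ₗ[k] W))) := by
  let g : L →ₗ[k] W ⧸ M := M.mkQ ∘ₗ (f : V →ₗ[k] W) ∘ₗ L.subtype
  have hg : IsOpen (LinearMap.ker g : Set L) := by
    have : (LinearMap.ker g : Set L) = (fun x : L ↦ f x) ⁻¹' (M : Set W) := by
      ext x
      simp [g]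
    rw [this]
    exact hM.preimage (f.continuous.comp continuous_subtype_val)
  have := hL.isLinearlyCompact.finite_quotient _ hg
  have h2 : Module.Finite k (LinearMap.range g) := Module.Finite.equiv g.quotKerEquivRange
  have h3 : LinearMap.range g = L.map (M.mkQ ∘ₗ (f : V →ₗ[k] W)) := by
    change LinearMap.range ((M.mkQ ∘ₗ (f : V →ₗ[k] W)) ∘ₗ L.subtype) = _
    rw [LinearMap.range_comp, Submodule.range_subtype]
  rwa [h3] at h2

theorem Q_map_eq_zero {V W : ModuleCat.{u} k} (f : V ⟶ W)
    (hf : Module.Finite k (LinearMap.range f.hom)) : (IndQuotient.Q k).map f = 0 := by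
  have h : f = ModuleCat.ofHom f.hom.rangeRestrict ≫
      ModuleCat.ofHom (LinearMap.range f.hom).subtype := by
    ext x
    rfl
  rw [h, Functor.map_comp]
  have hz : IsZero ((IndQuotient.Q k).obj (ModuleCat.of k (LinearMap.range f.hom))) :=
    (ObjectProperty.SerreClassLocalization.isZero_obj_iff (IndQuotient.Q k)
      (ModuleCat.isFG.{u} k) _).2 hf
  rw [hz.eq_of_tgt ((IndQuotient.Q k).map _) 0, zero_comp]

namespace ElTate

/-- For a continuous linear map `f : V → W`, the lattice `L_W + f(L_V)` of `W`, where `L_V` and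
`L_W` are the chosen lattices. -/
noncomputable def bigLattice {V W : ElTate k} (f : V ⟶ W) : Submodule k W.V :=
  W.lattice ⊔ V.lattice.map (Hom.toCLM f : V.V →ₗ[k] W.V)

/-- The map `V ⧸ L_V → W ⧸ (L_W + f(L_V))` induced by `f`. -/
noncomputable def redMap {V W : ElTate k} (f : V ⟶ W) :
    ModuleCat.of k (V.V ⧸ V.lattice) ⟶ ModuleCat.of k (W.V ⧸ bigLattice f) :=
  ModuleCat.ofHom (V.lattice.mapQ (bigLattice f) (Hom.toCLM f : V.V →ₗ[k] W.V)
    (Submodule.map_le_iff_le_comap.1 le_sup_right))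

/-- The projection `W ⧸ L_W → W ⧸ (L_W + f(L_V))`; its kernel is finite-dimensional. -/
noncomputable def redProj {V W : ElTate k} (f : V ⟶ W) :
    ModuleCat.of k (W.V ⧸ W.lattice) ⟶ ModuleCat.of k (W.V ⧸ bigLattice f) :=
  ModuleCat.ofHom (Submodule.factor (show W.lattice ≤ bigLattice f from le_sup_left))

theorem redProj_mem {V W : ElTate k} (f : V ⟶ W) :
    (ModuleCat.isFG.{u} k).isoModSerre (redProj f) := by
  have : Epi (redProj f) := by
    rw [ModuleCat.epi_iff_surjective]
    exact Submodule.factor_surjective (show W.lattice ≤ bigLattice f from le_sup_left)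
  rw [ObjectProperty.isoModSerre_iff_of_epi]
  refine (ModuleCat.isFG.{u} k).prop_of_iso (ModuleCat.kernelIsoKer (redProj f)).symm ?_
  have h : LinearMap.ker (redProj f).hom =
      V.lattice.map (W.lattice.mkQ ∘ₗ (Hom.toCLM f : V.V →ₗ[k] W.V)) := by
    change LinearMap.ker (Submodule.factor (show W.lattice ≤ bigLattice f from le_sup_left)) = _
    rw [Submodule.factor, Submodule.mapQ, Submodule.ker_liftQ, LinearMap.comp_id, Submodule.ker_mkQ,
      bigLattice, Submodule.map_sup, Submodule.mkQ_map_self, bot_sup_eq,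
      Submodule.map_comp]
  rw [ModuleCat.isFG_iff, h]
  exact finite_range_comp_subtype _ V.lattice_spec W.lattice_spec.isOpen

instance {V W : ElTate k} (f : V ⟶ W) : IsIso ((IndQuotient.Q k).map (redProj f)) :=
  Localization.inverts _ _ _ (redProj_mem f)

/-- The morphism `V ⧸ L_V → W ⧸ L_W` of `Ind^a(C) / C` induced by `f : V → W`: the composition of
`V ⧸ L_V → W ⧸ (L_W + f(L_V))` with the inverse of `W ⧸ L_W → W ⧸ (L_W + f(L_V))`. -/
noncomputable def toIndQuotientMap {V W : ElTate k} (f : V ⟶ W) :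
    (IndQuotient.Q k).obj (ModuleCat.of k (V.V ⧸ V.lattice)) ⟶
      (IndQuotient.Q k).obj (ModuleCat.of k (W.V ⧸ W.lattice)) :=
  (IndQuotient.Q k).map (redMap f) ≫ inv ((IndQuotient.Q k).map (redProj f))

/-- A linear map `φ` on the quotients which agrees with `f` up to a map of finite rank. -/
def IsLift {V W : ElTate k} (f : V ⟶ W) (φ : V.V ⧸ V.lattice →ₗ[k] W.V ⧸ W.lattice) : Prop :=
  Module.Finite k (LinearMap.range
    (φ ∘ₗ V.lattice.mkQ - W.lattice.mkQ ∘ₗ (Hom.toCLM f : V.V →ₗ[k] W.V)))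

theorem toIndQuotientMap_eq {V W : ElTate k} (f : V ⟶ W)
    (φ : V.V ⧸ V.lattice →ₗ[k] W.V ⧸ W.lattice) (h : IsLift f φ) :
    toIndQuotientMap f = (IndQuotient.Q k).map (ModuleCat.ofHom φ) := by
  rw [toIndQuotientMap, IsIso.comp_inv_eq, ← Functor.map_comp, ← sub_eq_zero, ← Functor.map_sub]
  apply Q_map_eq_zero
  have h1 : (redMap f - ModuleCat.ofHom φ ≫ redProj f).hom ∘ₗ V.lattice.mkQ =
      -((redProj f).hom ∘ₗ
        (φ ∘ₗ V.lattice.mkQ - W.lattice.mkQ ∘ₗ (Hom.toCLM f : V.V →ₗ[k] W.V))) := by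
    ext x
    change (redMap f).hom (V.lattice.mkQ x) - (redProj f).hom (φ (V.lattice.mkQ x)) =
      -((redProj f).hom (φ (V.lattice.mkQ x) - W.lattice.mkQ (Hom.toCLM f x)))
    rw [map_sub, neg_sub]
    rfl
  have h2 : LinearMap.range (redMap f - ModuleCat.ofHom φ ≫ redProj f).hom =
      (LinearMap.range (φ ∘ₗ V.lattice.mkQ - W.lattice.mkQ ∘ₗ
        (Hom.toCLM f : V.V →ₗ[k] W.V))).map (redProj f).hom := by
    rw [← LinearMap.range_comp, ← LinearMap.range_neg ((redProj f).hom ∘ₗ _), ← h1,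
      LinearMap.range_comp, Submodule.range_mkQ, Submodule.map_top]
  have h' : Module.Finite k _ := h
  rw [h2]
  infer_instance

theorem exists_isLift {V W : ElTate k} (f : V ⟶ W) : ∃ φ, IsLift f φ := by
  obtain ⟨s, hs⟩ := V.lattice.mkQ.exists_rightInverse_of_surjective V.lattice.range_mkQ
  refine ⟨W.lattice.mkQ ∘ₗ (Hom.toCLM f : V.V →ₗ[k] W.V) ∘ₗ s, ?_⟩
  have hfin := finite_range_comp_subtype (Hom.toCLM f) V.lattice_spec W.lattice_spec.isOpen
  refine Module.Finite.of_injective (Submodule.inclusion (p' := V.lattice.map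
    (W.lattice.mkQ ∘ₗ (Hom.toCLM f : V.V →ₗ[k] W.V))) ?_) (Submodule.inclusion_injective _)
  rintro _ ⟨x, rfl⟩
  refine ⟨s (V.lattice.mkQ x) - x, ?_, ?_⟩
  · have : V.lattice.mkQ (s (V.lattice.mkQ x)) = V.lattice.mkQ x :=
      LinearMap.congr_fun hs (V.lattice.mkQ x)
    exact (Submodule.Quotient.eq _).1 this
  · simp

theorem finite_range_add {V W : Type u} [AddCommGroup V] [Module k V] [AddCommGroup W] [Module k W]
    (f g : V →ₗ[k] W) (hf : Module.Finite k (LinearMap.range f))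
    (hg : Module.Finite k (LinearMap.range g)) : Module.Finite k (LinearMap.range (f + g)) := by
  have : Module.Finite k (LinearMap.range f ⊔ LinearMap.range g : Submodule k W) := inferInstance
  exact Module.Finite.of_injective _
    (Submodule.inclusion_injective (LinearMap.range_add_le f g))

theorem IsLift.add {V W : ElTate k} {f g : V ⟶ W} {φ ψ} (hf : IsLift f φ) (hg : IsLift g ψ) :
    IsLift (f + g) (φ + ψ) := by
  have h := finite_range_add _ _ hf hg
  have e : (φ + ψ) ∘ₗ V.lattice.mkQ - W.lattice.mkQ ∘ₗ (Hom.toCLM (f + g) : V.V →ₗ[k] W.V) =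
      (φ ∘ₗ V.lattice.mkQ - W.lattice.mkQ ∘ₗ (Hom.toCLM f : V.V →ₗ[k] W.V)) +
      (ψ ∘ₗ V.lattice.mkQ - W.lattice.mkQ ∘ₗ (Hom.toCLM g : V.V →ₗ[k] W.V)) := by
    ext x
    change φ (V.lattice.mkQ x) + ψ (V.lattice.mkQ x) -
      W.lattice.mkQ (Hom.toCLM f x + Hom.toCLM g x) =
      (φ (V.lattice.mkQ x) - W.lattice.mkQ (Hom.toCLM f x)) +
        (ψ (V.lattice.mkQ x) - W.lattice.mkQ (Hom.toCLM g x))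
    rw [map_add]
    abel
  unfold IsLift
  rw [e]
  exact h

theorem IsLift.comp {U V W : ElTate k} {f : U ⟶ V} {g : V ⟶ W} {φ ψ} (hf : IsLift f φ)
    (hg : IsLift g ψ) : IsLift (f ≫ g) (ψ ∘ₗ φ) := by
  have hf' : Module.Finite k _ := hf
  have hg' : Module.Finite k _ := hg
  have h := finite_range_add
    (ψ ∘ₗ (φ ∘ₗ U.lattice.mkQ - V.lattice.mkQ ∘ₗ (Hom.toCLM f : U.V →ₗ[k] V.V)))
    ((ψ ∘ₗ V.lattice.mkQ - W.lattice.mkQ ∘ₗ (Hom.toCLM g : V.V →ₗ[k] W.V)) ∘ₗ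
      (Hom.toCLM f : U.V →ₗ[k] V.V))
    (by
      rw [LinearMap.range_comp]
      infer_instance)
    (Module.Finite.of_injective _ (Submodule.inclusion_injective (LinearMap.range_comp_le_range _ _)))
  have e : (ψ ∘ₗ φ) ∘ₗ U.lattice.mkQ - W.lattice.mkQ ∘ₗ (Hom.toCLM (f ≫ g) : U.V →ₗ[k] W.V) =
      ψ ∘ₗ (φ ∘ₗ U.lattice.mkQ - V.lattice.mkQ ∘ₗ (Hom.toCLM f : U.V →ₗ[k] V.V)) +
      (ψ ∘ₗ V.lattice.mkQ - W.lattice.mkQ ∘ₗ (Hom.toCLM g : V.V →ₗ[k] W.V)) ∘ₗ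
        (Hom.toCLM f : U.V →ₗ[k] V.V) := by
    ext x
    change ψ (φ (U.lattice.mkQ x)) - W.lattice.mkQ (Hom.toCLM g (Hom.toCLM f x)) =
      ψ (φ (U.lattice.mkQ x) - V.lattice.mkQ (Hom.toCLM f x)) +
        (ψ (V.lattice.mkQ (Hom.toCLM f x)) - W.lattice.mkQ (Hom.toCLM g (Hom.toCLM f x)))
    rw [map_sub]
    abel
  unfold IsLift
  rw [e]
  exact h

theorem IsLift.id (V : ElTate k) : IsLift (𝟙 V) LinearMap.id := by
  have h : (LinearMap.id : V.V ⧸ V.lattice →ₗ[k] _) ∘ₗ V.lattice.mkQ -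
      V.lattice.mkQ ∘ₗ (Hom.toCLM (𝟙 V) : V.V →ₗ[k] V.V) = 0 := by
    ext x
    change V.lattice.mkQ x - V.lattice.mkQ x = 0
    exact sub_self _
  unfold IsLift
  rw [h, LinearMap.range_zero]
  infer_instance

variable (k) in
/-- The functor `elTate(k) ⥤ Ind^a(C) / C` sending `V` to `V ⧸ L` for a lattice `L` in `V`. -/
noncomputable def toIndQuotient : ElTate k ⥤ IndQuotient k where
  obj V := (IndQuotient.Q k).obj (ModuleCat.of k (V.V ⧸ V.lattice))
  map f := toIndQuotientMap f
  map_id V := by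
    rw [toIndQuotientMap_eq _ _ (IsLift.id V)]
    exact (IndQuotient.Q k).map_id _
  map_comp f g := by
    obtain ⟨φ, hφ⟩ := exists_isLift f
    obtain ⟨ψ, hψ⟩ := exists_isLift g
    rw [toIndQuotientMap_eq _ _ hφ, toIndQuotientMap_eq _ _ hψ,
      toIndQuotientMap_eq _ _ (hφ.comp hψ), ← Functor.map_comp]
    rfl

instance : (toIndQuotient k).Additive where
  map_add {V W f g} := by
    obtain ⟨φ, hφ⟩ := exists_isLift f
    obtain ⟨ψ, hψ⟩ := exists_isLift g
    change toIndQuotientMap _ = toIndQuotientMap _ + toIndQuotientMap _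
    rw [toIndQuotientMap_eq _ _ hφ, toIndQuotientMap_eq _ _ hψ,
      toIndQuotientMap_eq _ _ (hφ.add hψ)]
    exact (IndQuotient.Q k).map_add (f := ModuleCat.ofHom φ) (g := ModuleCat.ofHom ψ)

variable (k) in
/-- The natural functor from Tate spaces to Calkin objects, `V ↦ V ⧸ L`. -/
noncomputable def toCalk : ElTate k ⥤ Calk k :=
  toIndQuotient k ⋙ Idempotents.toKaroubi (IndQuotient k)

instance : (toCalk k).Additive := by
  unfold toCalk
  infer_instance

end ElTate

end Calkin

section FlatConnections

/-- A flat connection `(E, ∇)` on `F = k((t))`: a finite-dimensional `F`-vector space `E` with a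
`k`-linear map `∇ : E → E ⊗ Ω¹_F` satisfying the Leibniz rule.  (Flatness is automatic, since
`Ω²_F = 0`.) -/
structure FlatConnection (k : Type u) [Field k] where
  /-- the underlying vector space -/
  E : Type u
  [addCommGroup : AddCommGroup E]
  [moduleF : Module (LaurentSeries k) E]
  [module : Module k E]
  [isScalarTower : IsScalarTower k (LaurentSeries k) E]
  [finite : Module.Finite (LaurentSeries k) E]
  /-- the connection -/
  nabla : E →ₗ[k] E ⊗[LaurentSeries k] OneForm k
  leibniz : ∀ (f : LaurentSeries k) (e : E), nabla (f • e) = e ⊗ₜ OneForm.d f + f • nabla e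

attribute [instance] FlatConnection.addCommGroup FlatConnection.moduleF FlatConnection.module
  FlatConnection.isScalarTower FlatConnection.finite

namespace FlatConnection

variable {k : Type u} [Field k]

/-- Morphisms of flat connections: horizontal `F`-linear maps. -/
@[ext]
structure Hom (M N : FlatConnection k) where
  toLin : M.E →ₗ[LaurentSeries k] N.E
  horizontal : ∀ e : M.E, N.nabla (toLin e) = toLin.rTensor (OneForm k) (M.nabla e)

/-- The category `Loc(F)` of flat connections on `F = k((t))`. -/
noncomputable instance : Category (FlatConnection k) where
  Hom := Hom
  id M := ⟨LinearMap.id, by simp⟩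
  comp φ ψ := ⟨ψ.toLin ∘ₗ φ.toLin, fun e ↦ by
    rw [LinearMap.rTensor_comp, LinearMap.comp_apply, LinearMap.comp_apply, ψ.horizontal,
      φ.horizontal]⟩

@[ext]
theorem hom_ext {M N : FlatConnection k} {φ ψ : M ⟶ N} (h : φ.toLin = ψ.toLin) : φ = ψ :=
  Hom.ext h

@[simp]
theorem comp_toLin {M N P : FlatConnection k} (φ : M ⟶ N) (ψ : N ⟶ P) :
    (φ ≫ ψ).toLin = ψ.toLin ∘ₗ φ.toLin := rfl

section Preadditive

variable (M N : FlatConnection k)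

noncomputable instance : Zero (M ⟶ N) := ⟨⟨0, by simp⟩⟩

noncomputable instance : Add (M ⟶ N) := ⟨fun φ ψ ↦ ⟨φ.toLin + ψ.toLin, fun e ↦ by
  rw [LinearMap.rTensor_add, LinearMap.add_apply, LinearMap.add_apply, map_add, φ.horizontal,
    ψ.horizontal]⟩⟩

noncomputable instance : Neg (M ⟶ N) := ⟨fun φ ↦ ⟨-φ.toLin, fun e ↦ by
  rw [LinearMap.rTensor_neg, LinearMap.neg_apply, LinearMap.neg_apply, map_neg, φ.horizontal]⟩⟩

@[simp] theorem zero_toLin : Hom.toLin (0 : M ⟶ N) = 0 := rfl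

variable {M N}

@[simp] theorem add_toLin (φ ψ : M ⟶ N) : (φ + ψ).toLin = φ.toLin + ψ.toLin := rfl

@[simp] theorem neg_toLin (φ : M ⟶ N) : (-φ).toLin = -φ.toLin := rfl

noncomputable instance : Preadditive (FlatConnection k) where
  homGroup M N :=
    { add_assoc := fun _ _ _ ↦ by ext; simp [add_assoc]
      zero_add := fun _ ↦ by ext; simp
      add_zero := fun _ ↦ by ext; simp
      neg_add_cancel := fun _ ↦ by ext; simp
      add_comm := fun _ _ ↦ by ext; simp [add_comm]
      nsmul := nsmulRec
      zsmul := zsmulRec }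
  add_comp _ _ _ _ _ _ := by ext; simp
  comp_add _ _ _ _ _ _ := by ext; simp

end Preadditive

variable (k) in
/-- The conflations of `Loc(F)`: all short exact sequences of flat connections. -/
def conflations : ObjectProperty (ShortComplex (FlatConnection k)) := fun S ↦
  Function.Injective S.f.toLin ∧ Function.Exact S.f.toLin S.g.toLin ∧
    Function.Surjective S.g.toLin

theorem continuous_nabla (M : FlatConnection k) [TopologicalSpace M.E]
    [IsModuleTopology (LaurentSeries k) M.E]
    [TopologicalSpace (M.E ⊗[LaurentSeries k] OneForm k)]
    [IsModuleTopology (LaurentSeries k) (M.E ⊗[LaurentSeries k] OneForm k)] :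
    Continuous M.nabla := by
  have : ContinuousAdd (M.E ⊗[LaurentSeries k] OneForm k) :=
    IsModuleTopology.toContinuousAdd (LaurentSeries k) _
  let b := Module.finBasis (LaurentSeries k) M.E
  have h : ∀ x : M.E, M.nabla x =
      ∑ i, (b i ⊗ₜ OneForm.d (b.coord i x) + b.coord i x • M.nabla (b i)) := by
    intro x
    conv_lhs => rw [← b.sum_repr x]
    rw [map_sum]
    exact Finset.sum_congr rfl fun i _ ↦ M.leibniz _ _
  have hfun : (M.nabla : M.E → _) = fun x ↦
      ∑ i, (b i ⊗ₜ OneForm.d (b.coord i x) + b.coord i x • M.nabla (b i)) := funext h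
  rw [hfun]
  refine continuous_finsetSum _ fun i _ ↦ ?_
  have hc : Continuous (b.coord i) :=
    IsModuleTopology.continuous_of_linearMap (R := LaurentSeries k) (b.coord i)
  refine Continuous.add ?_ (hc.smul (continuous_const (y := M.nabla (b i))))
  let ψ : LaurentSeries k →ₗ[LaurentSeries k] M.E ⊗[LaurentSeries k] OneForm k :=
    TensorProduct.mk (LaurentSeries k) M.E (OneForm k) (b i)
  have hψ : Continuous ψ := IsModuleTopology.continuous_of_linearMap (R := LaurentSeries k) ψ
  have h3 : Continuous fun x ↦ ψ (LaurentSeries.derivative k (b.coord i x)) :=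
    hψ.comp ((continuous_derivative k).comp hc)
  exact h3

end FlatConnection

section Omega

variable {k : Type u} [Field k]

/-- A linear map of finite-dimensional `k((t))`-vector spaces as a morphism of Tate spaces. -/
noncomputable def ElTate.ofLinear {E E' : Type u} [AddCommGroup E] [Module (LaurentSeries k) E]
    [Module k E] [IsScalarTower k (LaurentSeries k) E] [Module.Finite (LaurentSeries k) E]
    [AddCommGroup E'] [Module (LaurentSeries k) E'] [Module k E']
    [IsScalarTower k (LaurentSeries k) E'] [Module.Finite (LaurentSeries k) E']
    (f : E →ₗ[LaurentSeries k] E') : ElTate.ofFinite (k := k) E ⟶ ElTate.ofFinite (k := k) E' :=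
  letI : TopologicalSpace E := moduleTopology (LaurentSeries k) E
  letI : TopologicalSpace E' := moduleTopology (LaurentSeries k) E'
  have : IsModuleTopology (LaurentSeries k) E := ⟨rfl⟩
  have : IsModuleTopology (LaurentSeries k) E' := ⟨rfl⟩
  have : ContinuousAdd E' := IsModuleTopology.toContinuousAdd (LaurentSeries k) E'
  show E →L[k] E' from
  { toLinearMap := f.restrictScalars k
    cont := IsModuleTopology.continuous_of_linearMap f }

/-- A connection `∇ : E → E ⊗ Ω¹_F` as a morphism of Tate spaces. -/
noncomputable def FlatConnection.nablaTate (M : FlatConnection k) :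
    ElTate.ofFinite (k := k) M.E ⟶ ElTate.ofFinite (k := k) (M.E ⊗[LaurentSeries k] OneForm k) :=
  letI : TopologicalSpace M.E := moduleTopology (LaurentSeries k) M.E
  letI : TopologicalSpace (M.E ⊗[LaurentSeries k] OneForm k) := moduleTopology (LaurentSeries k) _
  have : IsModuleTopology (LaurentSeries k) M.E := ⟨rfl⟩
  have : IsModuleTopology (LaurentSeries k) (M.E ⊗[LaurentSeries k] OneForm k) := ⟨rfl⟩
  show M.E →L[k] M.E ⊗[LaurentSeries k] OneForm k from
  { toLinearMap := M.nabla
    cont := M.continuous_nabla }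

/-- The morphism `E → E ⊗ Ω¹_F`, `e ↦ e ⊗ ν`, of Tate spaces. -/
noncomputable def FlatConnection.nuTate (ν : OneForm k) (M : FlatConnection k) :
    ElTate.ofFinite (k := k) M.E ⟶ ElTate.ofFinite (k := k) (M.E ⊗[LaurentSeries k] OneForm k) :=
  ElTate.ofLinear ((TensorProduct.mk (LaurentSeries k) M.E (OneForm k)).flip ν)

/-- The functor sending `(E, ∇)` to the binary complex `[E ⇉ E ⊗ Ω¹_F]` of Tate spaces, in
degrees `0` and `1`, with differentials `∇` and `ν`. -/
noncomputable def omegaTate (ν : OneForm k) : FlatConnection k ⥤ BinaryComplex (ElTate k) where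
  obj M := BinaryComplex.twoTerm (ElTate.zero k) M.nablaTate (M.nuTate ν)
  map {M N} φ := BinaryComplex.twoTermMap (ElTate.zero k) (ElTate.ofLinear φ.toLin)
    (ElTate.ofLinear (φ.toLin.rTensor (OneForm k)))
    (ContinuousLinearMap.ext fun e ↦ (φ.horizontal e).symm)
    (ContinuousLinearMap.ext fun _ ↦ rfl)
  map_id M := by
    ext j
    match j with
    | .ofNat 0 => rfl
    | .ofNat 1 => exact ContinuousLinearMap.ext fun x ↦
        LinearMap.congr_fun (LinearMap.rTensor_id (OneForm k) M.E) x
    | .ofNat (_ + 2) => rfl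
    | .negSucc _ => rfl
  map_comp {M N P} φ ψ := by
    ext j
    match j with
    | .ofNat 0 => rfl
    | .ofNat 1 => exact ContinuousLinearMap.ext fun x ↦
        LinearMap.congr_fun (LinearMap.rTensor_comp (OneForm k) ψ.toLin φ.toLin) x
    | .ofNat (_ + 2) => exact (Category.comp_id _).symm
    | .negSucc _ => exact (Category.comp_id _).symm

/-- The functor `Loc(F) ⥤ Bin(Calk(k))`, sending `(E, ∇)` to the image in `Calk(k)` of the binary
complex `[E ⇉ E ⊗ Ω¹_F]` with differentials `∇` and `ν`. -/
noncomputable def omega (ν : OneForm k) : FlatConnection k ⥤ BinaryComplex (Calk k) :=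
  omegaTate ν ⋙ BinaryComplex.mapFunctor (ElTate.toCalk k)

end Omega

end FlatConnections

end EpsilonFactor

/-! A complex concentrated in degrees 0 and 1 is exact in `Calk k` once its differential is
invertible there. A continuous map f : V → W becomes invertible once it is Fredholm modulo lattices:
f⁻¹(L_W) has finite-dimensional image in V/L_V, and W/(L_W + f(V)) is finite-dimensional
(`isIso_toCalk_map_of_finite`). The map e ↦ e ⊗ ν is already an isomorphism over F, because Ω¹ is a
line spanned by ν.

For ∇, contraction with t d/dt gives an operator D on E with D(fx) = θ(f)x + fD(x), where θ = t
d/dt. The Fredholm property becomes two uniform bounds: the x with D x in a given lattice lie in one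
lattice (`exists_mem_stdLattice_of_apply`), and E is the sum of D(E) and one lattice
(`exists_sub_apply_mem_stdLattice`). Both reduce to scalar operators on k((t)). The iterates of a
vector e satisfy a relation ∑ aᵢ Dⁱe = 0 over F, and integration by parts gives f Dⁱe ≡ ((-θ)ⁱf) e
modulo D(E), so ∑ (-θ)ⁱaᵢ controls the cokernel. Dually, a relation between the iterates of a
functional under the dual connection makes ∑ aᵢθⁱ control the poles of its values.

Such a scalar operator sends tⁿ to p(n) tⁿ⁺ᵛ plus higher terms, for a fixed v and a nonzero
polynomial p. In characteristic 0 only finitely many integers are roots of p, so the operator is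
invertible on all graded pieces of very negative degree. In characteristic p the claim fails: d
kills k((tᵖ)).

The functor preserves conflations because short exact sequences split F-linearly in each degree; the
splitting need not respect the connections. -/

namespace EpsilonFactor

/-! ### Split sequences in `Calk k` as conflations -/

section Splittings

/-- The comparison of two split short complexes with isomorphic outer terms. -/
noncomputable def isoOfSplittings {C : Type*} [Category C] [Preadditive C] {S T : ShortComplex C}
    (s : S.Splitting) (t : T.Splitting) (e₁ : S.X₁ ≅ T.X₁) (e₃ : S.X₃ ≅ T.X₃) : S ≅ T :=
  ShortComplex.isoMk e₁
    { hom := s.r ≫ e₁.hom ≫ T.f + S.g ≫ e₃.hom ≫ t.s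
      inv := t.r ≫ e₁.inv ≫ S.f + T.g ≫ e₃.inv ≫ s.s
      hom_inv_id := by simp [s.id]
      inv_hom_id := by simp [t.id] }
    e₃ (by simp) (by simp)

variable {k : Type u} [Field k]

/-- The sequence is isomorphic to the image of the biproduct sequence on `M₁` and `M₃`. The outer
terms have to come from vector spaces because a general object of the idempotent completion is only
a summand of such an image. -/
theorem Calk.conflations_of_splitting {S : ShortComplex (Calk k)} (s : S.Splitting)
    {M₁ M₃ : ModuleCat.{u} k}
    (e₁ : S.X₁ ≅ (IndQuotient.Q k ⋙ Idempotents.toKaroubi (IndQuotient k)).obj M₁)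
    (e₃ : S.X₃ ≅ (IndQuotient.Q k ⋙ Idempotents.toKaroubi (IndQuotient k)).obj M₃) :
    Calk.conflations k S := by
  let t := ShortComplex.Splitting.ofHasBinaryBiproduct M₁ M₃
  exact ⟨_, t.shortExact, ⟨Retract.ofIso (isoOfSplittings s
    (t.map (IndQuotient.Q k ⋙ Idempotents.toKaroubi (IndQuotient k))) e₁ e₃)⟩⟩

theorem Calk.conflations_of_splitting_of_elTate {S : ShortComplex (Calk k)} (s : S.Splitting)
    {V₁ V₃ : ElTate k} (e₁ : S.X₁ ≅ (ElTate.toCalk k).obj V₁)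
    (e₃ : S.X₃ ≅ (ElTate.toCalk k).obj V₃) : Calk.conflations k S :=
  Calk.conflations_of_splitting s (M₁ := .of k (V₁.V ⧸ V₁.lattice))
    (M₃ := .of k (V₃.V ⧸ V₃.lattice)) e₁ e₃

theorem ElTate.isZero_toCalk_zero : IsZero ((ElTate.toCalk k).obj (ElTate.zero k)) := by
  have h : 𝟙 (ElTate.zero k) = 0 :=
    ContinuousLinearMap.ext fun x ↦ Subsingleton.elim (α := PUnit) _ _
  rw [IsZero.iff_id_eq_zero, ← (ElTate.toCalk k).map_id, h, Functor.map_zero]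

end Splittings

/-! ### Acyclicity of two-term complexes -/

section Acyclic

variable {C : Type*} [Category C] [Preadditive C]

/-- The cycles of a two-term complex `X 0 ≅ X 1`. -/
def twoTermCycles (O : C) (X : ℤ → C) : ℤ → C
  | .ofNat 1 => X 1
  | .ofNat 0 => O
  | .ofNat (_ + 2) => O
  | .negSucc _ => O

/-- The inclusions of the cycles of a two-term complex `X 0 ≅ X 1`. -/
def twoTermCyclesι (O : C) (X : ℤ → C) : ∀ j, twoTermCycles O X j ⟶ X j
  | .ofNat 1 => 𝟙 (X 1)
  | .ofNat 0 => 0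
  | .ofNat (_ + 2) => 0
  | .negSucc _ => 0

/-- The projections onto the cycles of a two-term complex `X 0 ≅ X 1`. -/
def twoTermCyclesπ (O : C) (X : ℤ → C) (d : X 0 ⟶ X 1) : ∀ j, X j ⟶ twoTermCycles O X (j + 1)
  | .ofNat 0 => d
  | .ofNat (_ + 1) => 0
  | .negSucc _ => 0

/-- The only nonzero cycle object is `X 1`, in degree 1, so every sequence of cycles is split with a
zero end. `h𝓔` records exactly these features, which allow the outer terms to be identified with
objects coming from Tate spaces. -/
theorem isAcyclic_of_isIso {𝓔 : ObjectProperty (ShortComplex C)} {O : C} (hO : IsZero O)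
    (X : ℤ → C) (d : ∀ j, X j ⟶ X (j + 1)) (hX : ∀ j, j ≠ 0 → j ≠ 1 → IsZero (X j))
    (hd : IsIso (d 0))
    (h𝓔 : ∀ S : ShortComplex C, Nonempty S.Splitting → (∃ j, Nonempty (S.X₂ ≅ X j)) →
      (IsZero S.X₁ ∨ IsZero S.X₃) → 𝓔 S) : IsAcyclic 𝓔 X d := by
  let d₀ : X 0 ⟶ X 1 := d 0
  have : IsIso d₀ := hd
  have hneg : ∀ n : ℕ, IsZero (twoTermCycles O X (Int.negSucc n + 1))
    | 0 => hO
    | _ + 1 => hO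
  have hw : ∀ j, twoTermCyclesι O X j ≫ twoTermCyclesπ O X d₀ j = 0
    | .ofNat 0 => zero_comp
    | .ofNat 1 => comp_zero
    | .ofNat (_ + 2) => comp_zero
    | .negSucc _ => comp_zero
  refine ⟨twoTermCycles O X, twoTermCyclesι O X, twoTermCyclesπ O X d₀, hw, ?_, ?_⟩
  · rintro ((_ | n) | n)
    · exact Category.comp_id d₀
    · exact (hX (Int.ofNat (n + 1) + 1) (by simp; lia) (by simp; lia)).eq_of_tgt _ _
    · exact (hX (Int.negSucc n) (by simp) (by lia)).eq_of_src _ _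
  · rintro ((_ | _ | n) | n)
    · refine h𝓔 _ ⟨⟨0, (inv d₀ : X 1 ⟶ X 0), hO.eq_of_src _ _, IsIso.inv_hom_id d₀, ?_⟩⟩
        ⟨0, ⟨Iso.refl _⟩⟩ (Or.inl hO)
      exact (congrArg₂ (· + ·) zero_comp (IsIso.hom_inv_id d₀)).trans (zero_add _)
    · refine h𝓔 _ ⟨⟨𝟙 (X 1), 0, Category.comp_id (𝟙 (X 1)), hO.eq_of_src _ _, ?_⟩⟩
        ⟨1, ⟨Iso.refl _⟩⟩ (Or.inr hO)
      exact (congrArg₂ (· + ·) (Category.id_comp (𝟙 (X 1))) comp_zero).trans (add_zero _)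
    · have h2 := hX (Int.ofNat (n + 2)) (by simp; lia) (by simp; lia)
      exact h𝓔 _ ⟨⟨0, 0, hO.eq_of_src _ _, hO.eq_of_src _ _, h2.eq_of_src _ _⟩⟩
        ⟨_, ⟨Iso.refl _⟩⟩ (Or.inl hO)
    · have h2 := hX (Int.negSucc n) (by simp) (by lia)
      exact h𝓔 _ ⟨⟨0, 0, hO.eq_of_src _ _, (hneg n).eq_of_src _ _, h2.eq_of_src _ _⟩⟩
        ⟨_, ⟨Iso.refl _⟩⟩ (Or.inl hO)

end Acyclic

/-! ### The Fredholm criterion for isomorphisms in `Calk k` -/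

section TwoTermTate

variable {k : Type u} [Field k]

theorem isZero_twoTermX (V W : ElTate k) : ∀ j : ℤ, j ≠ 0 → j ≠ 1 →
    IsZero ((ElTate.toCalk k).obj (BinaryComplex.twoTermX (ElTate.zero k) V W j))
  | .ofNat 0, h, _ => absurd rfl h
  | .ofNat 1, _, h => absurd rfl h
  | .ofNat (_ + 2), _, _ => ElTate.isZero_toCalk_zero
  | .negSucc _, _, _ => ElTate.isZero_toCalk_zero

theorem isAcyclic_twoTerm {V W : ElTate k} (f : V ⟶ W) (hf : IsIso ((ElTate.toCalk k).map f)) :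
    IsAcyclic (Calk.conflations k)
      (fun j ↦ (ElTate.toCalk k).obj (BinaryComplex.twoTermX (ElTate.zero k) V W j))
      (fun j ↦ (ElTate.toCalk k).map (BinaryComplex.twoTermD (ElTate.zero k) f j)) := by
  refine isAcyclic_of_isIso ElTate.isZero_toCalk_zero _ _ (isZero_twoTermX V W) hf ?_
  rintro S ⟨s⟩ ⟨j, ⟨e⟩⟩ (h | h)
  -- With one end zero, the splitting makes the other end isomorphic to the middle term, which is
  -- the image of a Tate space.
  · have hg : IsIso S.g := ⟨s.s, by have := s.id; rwa [h.eq_of_tgt s.r 0, zero_comp, zero_add] at this,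
      s.s_g⟩
    exact Calk.conflations_of_splitting_of_elTate s (h.iso ElTate.isZero_toCalk_zero)
      ((asIso S.g).symm ≪≫ e)
  · have hg : IsIso S.f := ⟨s.r, s.f_r, by
      have := s.id; rwa [h.eq_of_tgt S.g 0, zero_comp, add_zero] at this⟩
    exact Calk.conflations_of_splitting_of_elTate s (asIso S.f ≪≫ e)
      (h.iso ElTate.isZero_toCalk_zero)

/-- The morphism induced by `f` is `redMap f` followed by the inverse of `redProj f`, so only
`redMap f` matters. -/
theorem isIso_toCalk_map {V W : ElTate k} (f : V ⟶ W)
    (hf : (ModuleCat.isFG.{u} k).isoModSerre (ElTate.redMap f)) :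
    IsIso ((ElTate.toCalk k).map f) := by
  have : IsIso ((IndQuotient.Q k).map (ElTate.redMap f)) := Localization.inverts _ _ _ hf
  have : IsIso ((ElTate.toIndQuotient k).map f) := by
    change IsIso ((IndQuotient.Q k).map (ElTate.redMap f) ≫
      inv ((IndQuotient.Q k).map (ElTate.redProj f)))
    infer_instance
  change IsIso ((Idempotents.toKaroubi (IndQuotient k)).map ((ElTate.toIndQuotient k).map f))
  infer_instance

theorem isoModSerre_isFG {M N : ModuleCat.{u} k} (f : M ⟶ N)
    (hk : Module.Finite k (LinearMap.ker f.hom))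
    (hc : Module.Finite k (N ⧸ LinearMap.range f.hom)) :
    (ModuleCat.isFG.{u} k).isoModSerre f := by
  constructor
  · refine (ModuleCat.isFG.{u} k).prop_of_iso (ModuleCat.kernelIsoKer f).symm ?_
    rw [ModuleCat.isFG_iff]
    exact hk
  · refine (ModuleCat.isFG.{u} k).prop_of_iso (ModuleCat.cokernelIsoRangeQuotient f).symm ?_
    rw [ModuleCat.isFG_iff]
    exact hc

/-- Criterion free of the enlarged lattice L_W + f(L_V): an x with f(x) in it can be corrected by an
element of L_V so that f(x) lies in L_W, and the cokernel of `redMap f` is a quotient of W/(L_W +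
f(V)). -/
theorem isIso_toCalk_map_of_finite {V W : ElTate k} (f : V ⟶ W)
    (hk : Module.Finite k ((W.lattice.comap (ElTate.Hom.toCLM f : V.V →ₗ[k] W.V)).map
      V.lattice.mkQ))
    (hc : Module.Finite k (W.V ⧸ (W.lattice ⊔
      LinearMap.range (ElTate.Hom.toCLM f : V.V →ₗ[k] W.V)))) :
    IsIso ((ElTate.toCalk k).map f) := by
  refine isIso_toCalk_map f (isoModSerre_isFG _ ?_ ?_)
  · refine Module.Finite.of_injective (Submodule.inclusion (p' := ((W.lattice.comap
      (ElTate.Hom.toCLM f : V.V →ₗ[k] W.V)).map V.lattice.mkQ)) ?_)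
      (Submodule.inclusion_injective _)
    intro x hx
    obtain ⟨x, rfl⟩ := V.lattice.mkQ_surjective x
    have hx' : ElTate.Hom.toCLM f x ∈ ElTate.bigLattice f :=
      (Submodule.Quotient.mk_eq_zero _).1 (LinearMap.mem_ker.1 hx)
    obtain ⟨w, hw, _, ⟨l, hl, rfl⟩, h⟩ := Submodule.mem_sup.1 hx'
    refine ⟨x - l, ?_, ?_⟩
    · change ElTate.Hom.toCLM f (x - l) ∈ W.lattice
      rw [map_sub, ← h]
      simpa using hw
    · rw [map_sub, sub_eq_self]
      exact (Submodule.Quotient.mk_eq_zero _).2 hl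
  · let q : W.V →ₗ[k] ((W.V ⧸ ElTate.bigLattice f) ⧸ LinearMap.range (ElTate.redMap f).hom) :=
      (LinearMap.range (ElTate.redMap f).hom).mkQ ∘ₗ (ElTate.bigLattice f).mkQ
    have hq : W.lattice ⊔ LinearMap.range (ElTate.Hom.toCLM f : V.V →ₗ[k] W.V) ≤
        LinearMap.ker q := by
      refine sup_le (fun w hw ↦ ?_) ?_
      · have : (ElTate.bigLattice f).mkQ w = 0 :=
          (Submodule.Quotient.mk_eq_zero _).2 ((le_sup_left : W.lattice ≤ ElTate.bigLattice f) hw)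
        rw [LinearMap.mem_ker, LinearMap.comp_apply, this, map_zero]
      · rintro _ ⟨x, rfl⟩
        exact (Submodule.Quotient.mk_eq_zero _).2 ⟨V.lattice.mkQ x, rfl⟩
    refine Module.Finite.of_surjective (Submodule.liftQ _ q hq) fun y ↦ ?_
    obtain ⟨y, rfl⟩ := (LinearMap.range (ElTate.redMap f).hom).mkQ_surjective y
    obtain ⟨y, rfl⟩ := (ElTate.bigLattice f).mkQ_surjective y
    exact ⟨Submodule.Quotient.mk y, rfl⟩

end TwoTermTate

/-! ### Comparison of arbitrary lattices with the standard ones -/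

section Lattices

variable {k : Type u} [Field k]

theorem fracIdeal_anti {m n : ℤ} (h : m ≤ n) : fracIdeal k n ≤ fracIdeal k m :=
  fun _ hf j hj ↦ hf j (hj.trans_le h)

theorem exists_mem_fracIdeal (f : LaurentSeries k) : ∃ n, f ∈ fracIdeal k n :=
  ⟨f.order, fun _ hj ↦ HahnSeries.coeff_eq_zero_of_lt_order hj⟩

theorem single_mul_mem_fracIdeal {n m : ℤ} {f : LaurentSeries k} (hf : f ∈ fracIdeal k m) :
    HahnSeries.single n (1 : k) * f ∈ fracIdeal k (n + m) := by
  intro j hj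
  rw [HahnSeries.coeff_single_mul, one_mul]
  exact hf _ (by lia)

theorem single_mul_single_neg (n : ℤ) :
    HahnSeries.single n (1 : k) * HahnSeries.single (-n) (1 : k) = 1 := by
  rw [HahnSeries.single_mul_single, add_neg_cancel, one_mul]
  rfl

variable {E : Type u} [AddCommGroup E] [Module (LaurentSeries k) E]
  [Module k E] [IsScalarTower k (LaurentSeries k) E]

theorem mem_stdLattice_of_forall_exists {m : ℕ} (b : Module.Basis (Fin m) (LaurentSeries k) E)
    (S : Set E) (h : ∀ i, ∃ n, ∀ x ∈ S, b.repr x i ∈ fracIdeal k n) :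
    ∃ n, ∀ x ∈ S, x ∈ stdLattice b n := by
  choose n hn using h
  -- A common lower bound for all the `n i`; a smaller index means a larger lattice.
  refine ⟨-∑ i, |n i|, fun x hx i ↦ fracIdeal_anti ?_ (hn i x hx)⟩
  have := Finset.single_le_sum (f := fun i ↦ |n i|) (fun _ _ ↦ abs_nonneg _) (Finset.mem_univ i)
  have := neg_abs_le (n i)
  lia

theorem exists_mem_stdLattice {m : ℕ} (b : Module.Basis (Fin m) (LaurentSeries k) E) (x : E) :
    ∃ n, x ∈ stdLattice b n := by
  obtain ⟨n, hn⟩ := mem_stdLattice_of_forall_exists b {x} fun i ↦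
    (exists_mem_fracIdeal (b.repr x i)).imp fun n hn y hy ↦ by rwa [hy]
  exact ⟨n, hn x rfl⟩

theorem le_stdLattice_of_fg {m : ℕ} (b : Module.Basis (Fin m) (LaurentSeries k) E)
    {P : Submodule k E} (hP : P.FG) : ∃ n, P ≤ stdLattice b n := by
  classical
  obtain ⟨s, rfl⟩ := hP
  induction s using Finset.induction_on with
  | empty => exact ⟨0, by simp⟩
  | insert a s ha ih =>
    obtain ⟨n, hn⟩ := ih
    obtain ⟨n', hn'⟩ := exists_mem_stdLattice b a
    refine ⟨min n n', ?_⟩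
    rw [Finset.coe_insert, Submodule.span_insert, sup_le_iff, Submodule.span_singleton_le_iff_mem]
    exact ⟨stdLattice_mono b (min_le_right _ _) hn', hn.trans (stdLattice_mono b (min_le_left _ _))⟩

variable [TopologicalSpace E] [IsModuleTopology (LaurentSeries k) E]

/-- Multiplication by tⁿ is continuous and carries the standard lattice of index 0, which is
linearly compact, onto the one of index `n`. -/
theorem finite_map_mkQ_stdLattice {m : ℕ} (b : Module.Basis (Fin m) (LaurentSeries k) E) (n : ℤ)
    {M : Submodule k E} (hM : IsOpen (M : Set E)) :
    Module.Finite k ((stdLattice b n).map M.mkQ) := by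
  have : IsTopologicalAddGroup E := IsModuleTopology.topologicalAddGroup (LaurentSeries k) E
  let T : E →L[k] E :=
    { toLinearMap := (LinearMap.lsmul (LaurentSeries k) E (HahnSeries.single n 1)).restrictScalars k
      cont := IsModuleTopology.continuous_of_linearMap
        (LinearMap.lsmul (LaurentSeries k) E (HahnSeries.single n (1 : k))) }
  have h := finite_range_comp_subtype T (stdLattice_isLattice b) hM
  refine Module.Finite.of_injective (Submodule.inclusion (p' := (stdLattice b 0).map
    (M.mkQ ∘ₗ (T : E →ₗ[k] E))) ?_) (Submodule.inclusion_injective _)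
  rintro _ ⟨x, hx, rfl⟩
  refine ⟨HahnSeries.single (-n) (1 : k) • x, fun i ↦ ?_, ?_⟩
  · rw [map_smul, Finsupp.smul_apply, smul_eq_mul, ← neg_add_cancel n]
    exact single_mul_mem_fracIdeal (hx i)
  · change M.mkQ (HahnSeries.single n (1 : k) • HahnSeries.single (-n) (1 : k) • x) = _
    rw [smul_smul, single_mul_single_neg, one_smul]

/-- Modulo the open subspace `stdLattice b 0`, the lattice becomes finite-dimensional, so finitely
many vectors account for the rest, and each of them has bounded poles. -/
theorem IsLattice.le_stdLattice {m : ℕ} (b : Module.Basis (Fin m) (LaurentSeries k) E)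
    {L : Submodule k E} (hL : IsLattice L) : ∃ n, L ≤ stdLattice b n := by
  have : IsTopologicalAddGroup E := IsModuleTopology.topologicalAddGroup (LaurentSeries k) E
  have h := finite_range_comp_subtype (ContinuousLinearMap.id k E) hL (stdLattice_isOpen b 0)
  obtain ⟨P, hP, hP'⟩ : ∃ P : Submodule k E, P.FG ∧
      P.map (stdLattice b 0).mkQ = L.map (stdLattice b 0).mkQ := by
    obtain ⟨s, hs⟩ := Module.Finite.iff_fg.1 h
    refine ⟨Submodule.span k (Function.surjInv (stdLattice b 0).mkQ_surjective '' s),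
      Submodule.fg_span (s.finite_toSet.image _), ?_⟩
    rw [Submodule.map_span, Set.image_image]
    simp only [Function.surjInv_eq, Set.image_id']
    exact hs
  obtain ⟨n, hn⟩ := le_stdLattice_of_fg b hP
  refine ⟨min n 0, fun x hx ↦ ?_⟩
  obtain ⟨p, hp, hpx⟩ : (stdLattice b 0).mkQ x ∈ P.map (stdLattice b 0).mkQ := hP' ▸ ⟨x, hx, rfl⟩
  have h1 := (Submodule.Quotient.eq _).1 hpx.symm
  have h2 := add_mem (stdLattice_mono b (min_le_right n 0) h1)
    (stdLattice_mono b (min_le_left n 0) (hn hp))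
  rwa [sub_add_cancel] at h2

end Lattices

/-! ### The criterion in terms of standard lattices -/

section Fredholm

variable {k : Type u} [Field k]
  {E : Type u} [AddCommGroup E] [Module (LaurentSeries k) E]
  [Module k E] [IsScalarTower k (LaurentSeries k) E] [Module.Finite (LaurentSeries k) E]
  {E' : Type u} [AddCommGroup E'] [Module (LaurentSeries k) E']
  [Module k E'] [IsScalarTower k (LaurentSeries k) E'] [Module.Finite (LaurentSeries k) E']

/-- The lattices used by `toCalk` are arbitrary choices. `h₁` bounds the preimage of a lattice and
`h₂` the cokernel; since every lattice lies in a standard one and a standard one is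
finite-dimensional modulo any open subspace, they give the two finiteness conditions. -/
theorem isIso_toCalk_map_ofFinite
    (f : ElTate.ofFinite (k := k) E ⟶ ElTate.ofFinite (k := k) E') (g : E →ₗ[k] E')
    (hf : (ElTate.Hom.toCLM f).toLinearMap = g)
    {m m' : ℕ} (b : Module.Basis (Fin m) (LaurentSeries k) E)
    (b' : Module.Basis (Fin m') (LaurentSeries k) E')
    (h₁ : ∀ n, ∃ l, ∀ x, g x ∈ stdLattice b' n → x ∈ stdLattice b l)
    (h₂ : ∃ n, ∀ y, ∃ x, y - g x ∈ stdLattice b' n) :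
    IsIso ((ElTate.toCalk k).map f) := by
  let _ : TopologicalSpace E := moduleTopology (LaurentSeries k) E
  let _ : TopologicalSpace E' := moduleTopology (LaurentSeries k) E'
  have : IsModuleTopology (LaurentSeries k) E := ⟨rfl⟩
  have : IsModuleTopology (LaurentSeries k) E' := ⟨rfl⟩
  let L : Submodule k E := (ElTate.ofFinite (k := k) E).lattice
  let L' : Submodule k E' := (ElTate.ofFinite (k := k) E').lattice
  have hL : IsLattice L := (ElTate.ofFinite (k := k) E).lattice_spec
  have hL' : IsLattice L' := (ElTate.ofFinite (k := k) E').lattice_spec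
  have hk : Module.Finite k ((L'.comap g).map L.mkQ) := by
    obtain ⟨n, hn⟩ := hL'.le_stdLattice b'
    obtain ⟨l, hl⟩ := h₁ n
    have := finite_map_mkQ_stdLattice b l hL.isOpen
    exact Module.Finite.of_injective (Submodule.inclusion (p' := (stdLattice b l).map L.mkQ)
      (Submodule.map_mono fun x hx ↦ hl x (hn hx))) (Submodule.inclusion_injective _)
  have hc : Module.Finite k (E' ⧸ (L' ⊔ LinearMap.range g)) := by
    obtain ⟨n, hn⟩ := h₂
    have := finite_map_mkQ_stdLattice b' n hL'.isOpen
    refine Module.Finite.of_surjective ((Submodule.factor (show L' ≤ L' ⊔ LinearMap.range g from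
      le_sup_left)) ∘ₗ ((stdLattice b' n).map L'.mkQ).subtype) fun y ↦ ?_
    obtain ⟨y, rfl⟩ := (L' ⊔ LinearMap.range g).mkQ_surjective y
    obtain ⟨x, hx⟩ := hn y
    refine ⟨⟨_, _, hx, rfl⟩, ?_⟩
    refine (Submodule.Quotient.eq _).2 ?_
    change y - g x - y ∈ _
    rw [sub_sub_cancel_left]
    exact neg_mem ((le_sup_right : _ ≤ L' ⊔ LinearMap.range g) ⟨x, rfl⟩)
  refine isIso_toCalk_map_of_finite f ?_ ?_
  · rw [hf]
    exact hk
  · rw [hf]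
    exact hc

end Fredholm

/-! ### Scalar differential operators and their symbols -/

section Operators

variable {k : Type u} [Field k]

variable (k) in
/-- The Euler operator `t d/dt` on `k((t))`. -/
noncomputable def eulerOp : Module.End k (LaurentSeries k) :=
  LinearMap.mulLeft k (HahnSeries.single 1 1 : LaurentSeries k) ∘ₗ
    (LaurentSeries.derivative k : LaurentSeries k →ₗ[k] LaurentSeries k)

theorem eulerOp_apply (f : LaurentSeries k) :
    eulerOp k f = HahnSeries.single 1 1 * LaurentSeries.derivative k f := rfl

theorem coeff_eulerOp (f : LaurentSeries k) (n : ℤ) :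
    (eulerOp k f).coeff n = n * f.coeff n := by
  rw [eulerOp_apply, HahnSeries.coeff_single_mul, one_mul, coeff_derivative, sub_add_cancel]
  push_cast
  ring

theorem eulerOp_mul (f g : LaurentSeries k) :
    eulerOp k (f * g) = f * eulerOp k g + g * eulerOp k f := by
  simp only [eulerOp_apply, derivative_mul]
  ring

theorem eulerOp_mem_fracIdeal {f : LaurentSeries k} {n : ℤ} (hf : f ∈ fracIdeal k n) :
    eulerOp k f ∈ fracIdeal k n := fun j hj ↦ by rw [coeff_eulerOp, hf j hj, mul_zero]

theorem mul_mem_fracIdeal {f g : LaurentSeries k} {m n : ℤ} (hf : f ∈ fracIdeal k m)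
    (hg : g ∈ fracIdeal k n) : f * g ∈ fracIdeal k (m + n) := by
  intro j hj
  rw [HahnSeries.coeff_mul]
  refine Finset.sum_eq_zero fun ij hij ↦ ?_
  have : ij.1 + ij.2 = j := by simpa using (Finset.mem_antidiagonal.1 hij).2.2
  by_cases h : ij.1 < m
  · rw [hf _ h, zero_mul]
  · rw [hg _ (by lia), mul_zero]

theorem coeff_mul_of_mem_fracIdeal {f g : LaurentSeries k} {m n : ℤ} (hf : f ∈ fracIdeal k m)
    (hg : g ∈ fracIdeal k n) : (f * g).coeff (m + n) = f.coeff m * g.coeff n := by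
  rw [HahnSeries.coeff_mul]
  refine Finset.sum_eq_single (m, n) (fun ij hij hne ↦ ?_) fun h ↦ ?_
  · have : ij.1 + ij.2 = m + n := by simpa using (Finset.mem_antidiagonal.1 hij).2.2
    by_cases h : ij.1 < m
    · rw [hf _ h, zero_mul]
    · rw [hg _ (lt_of_le_of_ne (by lia) fun h' ↦ hne (Prod.ext (by lia) h')), mul_zero]
  · by_contra hne
    exact h (Finset.mem_antidiagonal.2 ⟨left_ne_zero_of_mul hne, right_ne_zero_of_mul hne, rfl⟩)

/-- The operator `Q` shifts the `t`-adic filtration by `v`, acting on the `n`-th graded piece as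
multiplication by `φ n`. -/
def HasSymbol (Q : Module.End k (LaurentSeries k)) (v : ℤ) (φ : ℤ → k) : Prop :=
  ∀ n, ∀ f ∈ fracIdeal k n, Q f ∈ fracIdeal k (n + v) ∧ (Q f).coeff (n + v) = φ n * f.coeff n

theorem hasSymbol_eulerOp : HasSymbol (eulerOp k) 0 (fun n ↦ n) := fun n f hf ↦ by
  rw [add_zero]
  exact ⟨eulerOp_mem_fracIdeal hf, coeff_eulerOp f n⟩

theorem hasSymbol_mulLeft {a : LaurentSeries k} {v : ℤ} (ha : a ∈ fracIdeal k v) :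
    HasSymbol (LinearMap.mulLeft k a) v (fun _ ↦ a.coeff v) := fun n f hf ↦ by
  rw [add_comm]
  exact ⟨mul_mem_fracIdeal ha hf, coeff_mul_of_mem_fracIdeal ha hf⟩

namespace HasSymbol

variable {Q Q' : Module.End k (LaurentSeries k)} {v v' : ℤ} {φ φ' : ℤ → k}

/-- `Q'` acts first and raises the degree by `v'`, hence the argument `n + v'` of `φ`. -/
theorem mul (h : HasSymbol Q v φ) (h' : HasSymbol Q' v' φ') :
    HasSymbol (Q * Q') (v' + v) (fun n ↦ φ (n + v') * φ' n) := fun n f hf ↦ by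
  obtain ⟨h1, h2⟩ := h' n f hf
  obtain ⟨h3, h4⟩ := h _ _ h1
  rw [← add_assoc]
  exact ⟨h3, h4.trans (by rw [h2, mul_assoc])⟩

theorem neg (h : HasSymbol Q v φ) : HasSymbol (-Q) v (fun n ↦ -φ n) := fun n f hf ↦ by
  obtain ⟨h1, h2⟩ := h n f hf
  exact ⟨neg_mem h1, by simp [h2]⟩

theorem one : HasSymbol (1 : Module.End k (LaurentSeries k)) 0 (fun _ ↦ 1) := fun n f hf ↦ by
  rw [add_zero]
  exact ⟨hf, (one_mul _).symm⟩

theorem pow (h : HasSymbol Q 0 φ) : ∀ i : ℕ, HasSymbol (Q ^ i) 0 (fun n ↦ φ n ^ i)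
  | 0 => by simpa using one
  | i + 1 => by simpa [pow_succ] using (h.pow i).mul h

theorem sum {ι : Type*} (s : Finset ι) {Q : ι → Module.End k (LaurentSeries k)}
    {φ : ι → ℤ → k} (h : ∀ i, HasSymbol (Q i) v (φ i)) :
    HasSymbol (∑ i ∈ s, Q i) v (fun n ↦ ∑ i ∈ s, φ i n) := fun n f hf ↦ by
  rw [LinearMap.sum_apply]
  exact ⟨sum_mem fun i _ ↦ (h i n f hf).1, by
    rw [HahnSeries.coeff_sum, Finset.sum_mul]
    exact Finset.sum_congr rfl fun i _ ↦ (h i n f hf).2⟩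

/-- If `f` starts in a degree below `M`, its leading term survives under `Q`, so `Q f` has a pole
that is worse by exactly the shift `v`. -/
theorem exists_mem_fracIdeal_of_apply (h : HasSymbol Q v φ) {M : ℤ} (hM : ∀ n < M, φ n ≠ 0)
    (n : ℤ) : ∃ l, ∀ f, Q f ∈ fracIdeal k n → f ∈ fracIdeal k l := by
  refine ⟨min M (n - v), fun f hf j hj ↦ ?_⟩
  by_contra hj0
  have hf0 : f ≠ 0 := fun h ↦ hj0 (by rw [h, HahnSeries.coeff_zero])
  have hle : f.order ≤ j := HahnSeries.order_le_of_coeff_ne_zero hj0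
  have h1 := (h f.order f fun _ hj ↦ HahnSeries.coeff_eq_zero_of_lt_order hj).2
  rw [hf _ (by lia)] at h1
  exact mul_ne_zero (hM _ (by lia)) (HahnSeries.coeff_order_eq_zero.not.2 hf0) h1.symm

/-- Leading terms are removed one at a time. Only the finitely many degrees below `M + v` are
treated, so no convergence is involved. -/
theorem exists_sub_apply_mem_fracIdeal (h : HasSymbol Q v φ) {M : ℤ} (hM : ∀ n < M, φ n ≠ 0)
    (y : LaurentSeries k) : ∃ f, y - Q f ∈ fracIdeal k (M + v) := by
  have key : ∀ (N : ℕ) (y : LaurentSeries k), y ∈ fracIdeal k (M + v - N) →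
      ∃ f, y - Q f ∈ fracIdeal k (M + v) := by
    intro N
    induction N with
    | zero => exact fun y hy ↦ ⟨0, by simpa using hy⟩
    | succ N ih =>
      intro y hy
      -- The degree for which `a + v` is the lowest possible degree of `y`; as `a < M`, the symbol
      -- can be divided by.
      set a : ℤ := M - (N + 1) with ha
      have hs : HahnSeries.single a (y.coeff (a + v) / φ a) ∈ fracIdeal k a :=
        fun j hj ↦ HahnSeries.coeff_single_of_ne hj.ne
      obtain ⟨h1, h2⟩ := h a _ hs
      rw [HahnSeries.coeff_single_same, mul_div_cancel₀ _ (hM a (by lia))] at h2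
      obtain ⟨f, hf⟩ := ih (y - Q (HahnSeries.single a (y.coeff (a + v) / φ a))) (by
        intro j hj
        rw [HahnSeries.coeff_sub]
        rcases (show j ≤ a + v by lia).lt_or_eq with hj' | rfl
        · rw [h1 j hj', hy j (by push_cast; lia), sub_zero]
        · rw [h2, sub_self])
      exact ⟨_ + f, by rwa [map_add, ← sub_sub]⟩
  obtain ⟨n, hn⟩ := exists_mem_fracIdeal y
  exact key (M + v - n).toNat y (fracIdeal_anti (by lia) hn)

end HasSymbol

theorem exists_common_order {ι : Type*} [Fintype ι] (a : ι → LaurentSeries k)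
    (ha : ∃ i, a i ≠ 0) : ∃ v, (∀ i, a i ∈ fracIdeal k v) ∧ ∃ i, (a i).coeff v ≠ 0 := by
  classical
  obtain ⟨i, hi, hmin⟩ := Finset.exists_min_image (Finset.univ.filter fun i ↦ a i ≠ 0)
    (fun i ↦ (a i).order) (by simpa [Finset.filter_nonempty_iff] using ha)
  refine ⟨(a i).order, fun j n hn ↦ ?_, i, HahnSeries.coeff_order_eq_zero.not.2 (by simpa using hi)⟩
  by_cases hj : a j = 0
  · rw [hj, HahnSeries.coeff_zero]
  · exact HahnSeries.coeff_eq_zero_of_lt_order (hn.trans_le (hmin j (by simpa using hj)))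

/-- A nonzero polynomial has finitely many roots, and in characteristic 0 distinct integers stay
distinct in `k`. -/
theorem exists_forall_sum_pow_ne_zero [CharZero k] {N : ℕ} (c : Fin N → k) (hc : ∃ i, c i ≠ 0) :
    ∃ B : ℤ, ∀ n : ℤ, B < |n| → ∑ i, c i * (n : k) ^ (i : ℕ) ≠ 0 := by
  classical
  let p : Polynomial k := ∑ i : Fin N, Polynomial.monomial (i : ℕ) (c i)
  have hp : p ≠ 0 := by
    obtain ⟨i, hi⟩ := hc
    intro h
    apply hi
    have h1 : p.coeff i = c i := by
      simp [p, Polynomial.finsetSum_coeff, Polynomial.coeff_monomial, Fin.val_inj]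
    rw [← h1, h, Polynomial.coeff_zero]
  have hfin : {n : ℤ | p.IsRoot (n : k)}.Finite :=
    (Polynomial.finite_setOfPred_isRoot hp).preimage Int.cast_injective.injOn
  obtain ⟨B, hB⟩ := (hfin.image fun n ↦ |n|).bddAbove
  refine ⟨B, fun n hn h ↦ hn.not_ge (hB ⟨n, ?_, rfl⟩)⟩
  simpa [p, Polynomial.eval_finsetSum] using h

theorem hasSymbol_sum_mul_eulerOp_pow {N : ℕ} {a : Fin N → LaurentSeries k} {v : ℤ}
    (ha : ∀ i, a i ∈ fracIdeal k v) :
    HasSymbol (∑ i, LinearMap.mulLeft k (a i) * eulerOp k ^ (i : ℕ)) v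
      (fun n ↦ ∑ i, (a i).coeff v * (n : k) ^ (i : ℕ)) :=
  HasSymbol.sum _ fun i ↦ by
    simpa using (hasSymbol_mulLeft (ha i)).mul (hasSymbol_eulerOp.pow (i : ℕ))

theorem hasSymbol_sum_neg_eulerOp_pow_mul {N : ℕ} {a : Fin N → LaurentSeries k} {v : ℤ}
    (ha : ∀ i, a i ∈ fracIdeal k v) :
    HasSymbol (∑ i : Fin N, (-eulerOp k) ^ (i : ℕ) * LinearMap.mulLeft k (a i)) v
      (fun n ↦ ∑ i, (a i).coeff v * ((-(n + v) : ℤ) : k) ^ (i : ℕ)) :=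
  HasSymbol.sum _ fun i ↦ by
    simpa [mul_comm] using (hasSymbol_eulerOp.neg.pow (i : ℕ)).mul (hasSymbol_mulLeft (ha i))

variable [CharZero k] {N : ℕ} {a : Fin N → LaurentSeries k}

theorem exists_mem_fracIdeal_of_sum_mul_eulerOp_pow (ha : ∃ i, a i ≠ 0) (n : ℤ) :
    ∃ l, ∀ f, ∑ i, a i * (eulerOp k ^ (i : ℕ)) f ∈ fracIdeal k n → f ∈ fracIdeal k l := by
  obtain ⟨v, hv, hv'⟩ := exists_common_order a ha
  obtain ⟨B, hB⟩ := exists_forall_sum_pow_ne_zero _ hv'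
  obtain ⟨l, hl⟩ := (hasSymbol_sum_mul_eulerOp_pow hv).exists_mem_fracIdeal_of_apply
    (M := -|B|) (fun n hn ↦ hB n (by grind)) n
  exact ⟨l, fun f hf ↦ hl f (by simpa [LinearMap.sum_apply] using hf)⟩

theorem exists_sub_sum_neg_eulerOp_pow_mem_fracIdeal (ha : ∃ i, a i ≠ 0) :
    ∃ l, ∀ y, ∃ f, y - ∑ i : Fin N, ((-eulerOp k) ^ (i : ℕ)) (a i * f) ∈ fracIdeal k l := by
  obtain ⟨v, hv, hv'⟩ := exists_common_order a ha
  obtain ⟨B, hB⟩ := exists_forall_sum_pow_ne_zero _ hv'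
  -- Below `-|B| - v` the argument `-(n + v)` of the polynomial exceeds `|B|`.
  refine ⟨-|B| - v + v, fun y ↦ ((hasSymbol_sum_neg_eulerOp_pow_mul hv).exists_sub_apply_mem_fracIdeal
    (M := -|B| - v) (fun n hn ↦ hB _ (by grind)) y).imp fun f hf ↦ ?_⟩
  rwa [LinearMap.sum_apply] at hf

end Operators

/-! ### Pole bounds for differential modules -/

section DifferentialModules

variable {k : Type u} [Field k]

/-- A family of Laurent series has bounded poles. -/
def BoundedPoles {X : Type*} (g : X → LaurentSeries k) : Prop :=
  ∃ n, ∀ x, g x ∈ fracIdeal k n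

namespace BoundedPoles

variable {X : Type*} {g g' : X → LaurentSeries k}

theorem add (h : BoundedPoles g) (h' : BoundedPoles g') : BoundedPoles fun x ↦ g x + g' x := by
  obtain ⟨n, hn⟩ := h
  obtain ⟨n', hn'⟩ := h'
  exact ⟨min n n', fun x ↦ add_mem (fracIdeal_anti (min_le_left _ _) (hn x))
    (fracIdeal_anti (min_le_right _ _) (hn' x))⟩

theorem neg (h : BoundedPoles g) : BoundedPoles fun x ↦ -g x :=
  h.imp fun _ hn x ↦ neg_mem (hn x)

theorem zero : BoundedPoles fun _ : X ↦ (0 : LaurentSeries k) := ⟨0, fun _ ↦ zero_mem _⟩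

theorem const_mul (a : LaurentSeries k) (h : BoundedPoles g) : BoundedPoles fun x ↦ a * g x := by
  obtain ⟨n, hn⟩ := h
  obtain ⟨m, hm⟩ := exists_mem_fracIdeal a
  exact ⟨m + n, fun x ↦ mul_mem_fracIdeal hm (hn x)⟩

theorem eulerOp (h : BoundedPoles g) : BoundedPoles fun x ↦ EpsilonFactor.eulerOp k (g x) :=
  h.imp fun _ hn x ↦ eulerOp_mem_fracIdeal (hn x)

theorem sum {ι : Type*} (s : Finset ι) {g : ι → X → LaurentSeries k}
    (h : ∀ i, BoundedPoles (g i)) : BoundedPoles fun x ↦ ∑ i ∈ s, g i x := by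
  classical
  induction s using Finset.induction_on with
  | empty => simpa using zero
  | insert i s hi ih => simpa only [Finset.sum_insert hi] using (h i).add ih

end BoundedPoles

variable {E : Type u} [AddCommGroup E] [Module (LaurentSeries k) E]
  [Module k E] {D : Module.End k E}

/-- Integration by parts: modulo the range of `D`, f D(x) ≡ -θ(f) x, and each application moves one
`D` from the vector to the coefficient. -/
theorem smul_pow_apply_sub_mem_range
    (hD : ∀ (f : LaurentSeries k) (x : E), D (f • x) = eulerOp k f • x + f • D x) (e : E) :
    ∀ (i : ℕ) (f : LaurentSeries k),
      f • (D ^ i) e - ((-eulerOp k) ^ i) f • e ∈ LinearMap.range D := by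
  intro i
  induction i with
  | zero => simp
  | succ i ih =>
    intro f
    have h := add_mem (LinearMap.mem_range_self D (f • (D ^ i) e)) (ih (-eulerOp k f))
    rw [hD] at h
    convert! h using 1
    rw [pow_succ', pow_succ, Module.End.mul_apply, Module.End.mul_apply, LinearMap.neg_apply,
      neg_smul]
    abel

/-- The connection on the dual of a differential module. -/
noncomputable def dualOp
    (hD : ∀ (f : LaurentSeries k) (x : E), D (f • x) = eulerOp k f • x + f • D x)
    (μ : E →ₗ[LaurentSeries k] LaurentSeries k) : E →ₗ[LaurentSeries k] LaurentSeries k where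
  toFun x := eulerOp k (μ x) - μ (D x)
  map_add' x y := by
    simp only [map_add]
    abel
  map_smul' f x := by
    simp only [hD, map_add, map_smul, smul_eq_mul, eulerOp_mul, RingHom.id_apply]
    ring

variable [IsScalarTower k (LaurentSeries k) E]

theorem boundedPoles_functional {m : ℕ} (b : Module.Basis (Fin m) (LaurentSeries k) E)
    (μ : E →ₗ[LaurentSeries k] LaurentSeries k) {X : Type*} {g : X → E} {n : ℤ}
    (hg : ∀ x, g x ∈ stdLattice b n) : BoundedPoles fun x ↦ μ (g x) := by
  have h : ∀ y, μ y = ∑ i, μ (b i) * b.repr y i := fun y ↦ by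
    conv_lhs => rw [← b.sum_repr y]
    simp only [map_sum, map_smul, smul_eq_mul, mul_comm]
  rw [funext fun x ↦ h (g x)]
  exact BoundedPoles.sum _ fun i ↦ BoundedPoles.const_mul _ ⟨n, fun x ↦ hg x i⟩

/-- By definition of the dual connection, θ(μ(x)) = μ*(x) + μ(D x) with μ* the dual derivative of μ.
The last term is bounded on the given family, and θ preserves bounded poles, so the error remains
bounded under iteration. -/
theorem boundedPoles_iterate_dualOp
    (hD : ∀ (f : LaurentSeries k) (x : E), D (f • x) = eulerOp k f • x + f • D x)
    {m : ℕ} (b : Module.Basis (Fin m) (LaurentSeries k) E)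
    (μ : E →ₗ[LaurentSeries k] LaurentSeries k) {X : Type*} {g : X → E} {n : ℤ}
    (hg : ∀ x, D (g x) ∈ stdLattice b n) (i : ℕ) :
    BoundedPoles fun x ↦ (eulerOp k ^ i) (μ (g x)) - ((dualOp hD)^[i] μ) (g x) := by
  induction i with
  | zero => simpa using BoundedPoles.zero
  | succ i ih =>
    convert! ih.eulerOp.add (boundedPoles_functional b ((dualOp hD)^[i] μ) hg) using 2 with x
    rw [Function.iterate_succ_apply', pow_succ', Module.End.mul_apply, map_sub]
    change _ - (eulerOp k _ - _) = _
    abel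

variable [CharZero k] [Module.Finite (LaurentSeries k) E]

/-- Each coordinate is bounded separately. The iterates of a coordinate functional under the dual
connection are linearly dependent, so the coordinate is sent to bounded poles by a nonzero scalar
operator, which forces a uniform bound on the coordinate itself. -/
theorem exists_mem_stdLattice_of_apply
    (hD : ∀ (f : LaurentSeries k) (x : E), D (f • x) = eulerOp k f • x + f • D x)
    {m : ℕ} (b : Module.Basis (Fin m) (LaurentSeries k) E) (n : ℤ) :
    ∃ l, ∀ x, D x ∈ stdLattice b n → x ∈ stdLattice b l := by
  refine mem_stdLattice_of_forall_exists b {x | D x ∈ stdLattice b n} fun j ↦ ?_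
  -- One more iterate than the dimension, to force a linear relation.
  let v : Fin (Module.finrank (LaurentSeries k) (E →ₗ[LaurentSeries k] LaurentSeries k) + 1) →
    (E →ₗ[LaurentSeries k] LaurentSeries k) := fun i ↦ (dualOp hD)^[(i : ℕ)] (b.coord j)
  have hv : ¬ LinearIndependent (LaurentSeries k) v := fun h ↦ by
    simpa using h.fintype_card_le_finrank
  obtain ⟨a, ha, ha'⟩ := Fintype.not_linearIndependent_iff.1 hv
  obtain ⟨N, hN⟩ := BoundedPoles.sum Finset.univ fun i ↦ BoundedPoles.const_mul (a i)
    (boundedPoles_iterate_dualOp hD b (b.coord j)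
      (g := fun x : {x | D x ∈ stdLattice b n} ↦ (x : E)) (fun x ↦ x.2) i)
  obtain ⟨l, hl⟩ := exists_mem_fracIdeal_of_sum_mul_eulerOp_pow ha' N
  refine ⟨l, fun x hx ↦ hl _ ?_⟩
  convert! hN ⟨x, hx⟩ using 1
  have h0 : ∑ i, a i * v i x = 0 := by
    simpa using LinearMap.congr_fun ha x
  simp only [mul_sub, Finset.sum_sub_distrib]
  exact (sub_eq_self.2 h0).symm

/-- On each basis line, a relation between the iterates of `b j` and integration by parts place the
multiples of `b j` by values of a nonzero scalar operator in the range of `D`. That operator reaches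
every Laurent series up to bounded poles; the coordinates are then summed. -/
theorem exists_sub_apply_mem_stdLattice
    (hD : ∀ (f : LaurentSeries k) (x : E), D (f • x) = eulerOp k f • x + f • D x)
    {m : ℕ} (b : Module.Basis (Fin m) (LaurentSeries k) E) :
    ∃ n, ∀ y, ∃ x, y - D x ∈ stdLattice b n := by
  have h : ∀ j, ∃ l, ∀ f : LaurentSeries k, ∃ h ∈ fracIdeal k l,
      (f - h) • b j ∈ LinearMap.range D := by
    intro j
    let v : Fin (Module.finrank (LaurentSeries k) E + 1) → E := fun i ↦ (D ^ (i : ℕ)) (b j)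
    have hv : ¬ LinearIndependent (LaurentSeries k) v := fun h ↦ by
      simpa using h.fintype_card_le_finrank
    obtain ⟨a, ha, ha'⟩ := Fintype.not_linearIndependent_iff.1 hv
    obtain ⟨l, hl⟩ := exists_sub_sum_neg_eulerOp_pow_mem_fracIdeal ha'
    refine ⟨l, fun y ↦ ?_⟩
    obtain ⟨f, hf⟩ := hl y
    refine ⟨_, hf, ?_⟩
    rw [sub_sub_cancel, Finset.sum_smul]
    have h1 := sum_mem (S := LinearMap.range D) (t := Finset.univ) fun i _ ↦
      smul_pow_apply_sub_mem_range hD (b j)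
        ((i : Fin (Module.finrank (LaurentSeries k) E + 1)) : ℕ) (a i * f)
    have h0 : ∑ i, (a i * f) • v i = 0 := by
      simp only [mul_comm _ f, mul_smul, ← Finset.smul_sum, ha, smul_zero]
    rw [Finset.sum_sub_distrib, show ∑ i, (a i * f) • (D ^ (i : ℕ)) (b j) = 0 from h0, zero_sub,
      neg_mem_iff] at h1
    exact h1
  choose l hl using h
  choose r hr hr' using hl
  -- The remainders `r j` have a pole bound independent of `y`, so all their combinations lie in one
  -- lattice.
  obtain ⟨n, hn⟩ := mem_stdLattice_of_forall_exists b
    (Set.range fun y ↦ ∑ j, r j (b.repr y j) • b j) fun j ↦ ⟨l j, by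
      rintro _ ⟨y, rfl⟩
      simpa [Finsupp.single_apply] using hr j (b.repr y j)⟩
  refine ⟨n, fun y ↦ ?_⟩
  obtain ⟨x, hx⟩ := sum_mem (S := LinearMap.range D) (t := Finset.univ) fun j _ ↦ hr' j (b.repr y j)
  refine ⟨x, ?_⟩
  convert! hn _ ⟨y, rfl⟩ using 1
  simp only [hx, sub_smul, Finset.sum_sub_distrib, b.sum_repr, sub_sub_cancel]

end DifferentialModules

/-! ### Contraction with t d/dt, and exactness of the functor -/

section Contraction

variable {k : Type u} [Field k]

variable (k) in
/-- The coefficient of a one-form, as a linear isomorphism `Ω¹_F ≃ F`. -/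
noncomputable def OneForm.coeffEquiv : OneForm k ≃ₗ[LaurentSeries k] LaurentSeries k :=
  LinearEquiv.refl (LaurentSeries k) (LaurentSeries k)

/-- The isomorphism `E ⊗ Ω¹_F ≃ E`, `e ⊗ g dt ↦ g e`. -/
noncomputable def tensorOneFormEquiv (E : Type u) [AddCommGroup E] [Module (LaurentSeries k) E] :
    E ⊗[LaurentSeries k] OneForm k ≃ₗ[LaurentSeries k] E :=
  TensorProduct.congr (LinearEquiv.refl _ E) (OneForm.coeffEquiv k) ≪≫ₗ TensorProduct.rid _ E

theorem tensorOneFormEquiv_tmul {E : Type u} [AddCommGroup E] [Module (LaurentSeries k) E]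
    (e : E) (ω : OneForm k) :
    tensorOneFormEquiv E (e ⊗ₜ ω) = OneForm.coeffEquiv k ω • e := rfl

variable (M : FlatConnection k)

/-- The contraction `E ⊗ Ω¹_F ≃ E` with the vector field `t d/dt`. -/
noncomputable def FlatConnection.contraction :
    M.E ⊗[LaurentSeries k] OneForm k ≃ₗ[LaurentSeries k] M.E :=
  tensorOneFormEquiv M.E ≪≫ₗ LinearEquiv.smulOfNeZero (LaurentSeries k) M.E
    (HahnSeries.single 1 1 : LaurentSeries k) (by simp)

theorem FlatConnection.contraction_tmul (e : M.E) (ω : OneForm k) :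
    M.contraction (e ⊗ₜ ω) = (HahnSeries.single 1 1 * OneForm.coeffEquiv k ω) • e :=
  (mul_smul _ _ _).symm

/-- The covariant derivative along the vector field `t d/dt`. -/
noncomputable def FlatConnection.eulerDeriv : Module.End k M.E :=
  (M.contraction.toLinearMap.restrictScalars k) ∘ₗ M.nabla

theorem FlatConnection.eulerDeriv_smul (f : LaurentSeries k) (x : M.E) :
    M.eulerDeriv (f • x) = eulerOp k f • x + f • M.eulerDeriv x := by
  change M.contraction (M.nabla (f • x)) = _ + f • M.contraction (M.nabla x)
  rw [M.leibniz, map_add, map_smul, M.contraction_tmul]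
  rfl

theorem isIso_toCalk_map_nablaTate [CharZero k] : IsIso ((ElTate.toCalk k).map M.nablaTate) := by
  let b := Module.finBasis (LaurentSeries k) M.E
  -- With this basis of the target, contraction matches the standard lattices with no shift by t, so
  -- the bounds for `eulerDeriv` apply to `nabla` unchanged.
  let b' := b.map M.contraction.symm
  have hb' : ∀ n y, y ∈ stdLattice b' n ↔ M.contraction y ∈ stdLattice b n := fun n y ↦ Iff.rfl
  refine isIso_toCalk_map_ofFinite M.nablaTate M.nabla rfl b b' (fun n ↦ ?_) ?_
  · exact exists_mem_stdLattice_of_apply M.eulerDeriv_smul b n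
  · obtain ⟨n, hn⟩ := exists_sub_apply_mem_stdLattice M.eulerDeriv_smul b
    refine ⟨n, fun y ↦ (hn (M.contraction y)).imp fun x hx ↦ ?_⟩
    rw [hb', map_sub]
    exact hx

variable {E E' E'' : Type u} [AddCommGroup E] [Module (LaurentSeries k) E]
    [Module k E] [IsScalarTower k (LaurentSeries k) E] [Module.Finite (LaurentSeries k) E]
    [AddCommGroup E'] [Module (LaurentSeries k) E'] [Module k E']
    [IsScalarTower k (LaurentSeries k) E'] [Module.Finite (LaurentSeries k) E']
    [AddCommGroup E''] [Module (LaurentSeries k) E''] [Module k E'']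
    [IsScalarTower k (LaurentSeries k) E''] [Module.Finite (LaurentSeries k) E'']

theorem ElTate.ofLinear_comp (f : E →ₗ[LaurentSeries k] E') (g : E' →ₗ[LaurentSeries k] E'') :
    ElTate.ofLinear f ≫ ElTate.ofLinear g = ElTate.ofLinear (k := k) (g ∘ₗ f) := rfl

theorem ElTate.ofLinear_id :
    ElTate.ofLinear (LinearMap.id : E →ₗ[LaurentSeries k] E) = 𝟙 (ElTate.ofFinite (k := k) E) := rfl

theorem ElTate.ofLinear_add (f g : E →ₗ[LaurentSeries k] E') :
    ElTate.ofLinear (k := k) (f + g) = ElTate.ofLinear f + ElTate.ofLinear g := rfl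

theorem ElTate.isIso_ofLinear (f : E →ₗ[LaurentSeries k] E') (hf : Function.Bijective f) :
    IsIso (ElTate.ofLinear (k := k) f) := by
  let e := LinearEquiv.ofBijective f hf
  refine ⟨ElTate.ofLinear e.symm.toLinearMap, ?_, ?_⟩
  · rw [ElTate.ofLinear_comp, ← ElTate.ofLinear_id]
    exact congrArg _ (LinearMap.ext e.symm_apply_apply)
  · rw [ElTate.ofLinear_comp, ← ElTate.ofLinear_id]
    exact congrArg _ (LinearMap.ext e.apply_symm_apply)

theorem isIso_nuTate {ν : OneForm k} (hν : ν ≠ 0) : IsIso (M.nuTate ν) := by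
  refine ElTate.isIso_ofLinear _ ?_
  have h0 : OneForm.coeffEquiv k ν ≠ 0 := hν
  have h : ⇑((TensorProduct.mk (LaurentSeries k) M.E (OneForm k)).flip ν) =
      (LinearEquiv.smulOfNeZero (LaurentSeries k) M.E _ h0 ≪≫ₗ (tensorOneFormEquiv M.E).symm) := by
    ext e
    exact (LinearEquiv.eq_symm_apply _).2 (tensorOneFormEquiv_tmul e ν)
  rw [h]
  exact LinearEquiv.bijective _

theorem isExact_omega_obj [CharZero k] {ν : OneForm k} (hν : ν ≠ 0) :
    ((omega ν).obj M).IsExact (Calk.conflations k) := by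
  have := isIso_nuTate M hν
  exact ⟨isAcyclic_twoTerm M.nablaTate (isIso_toCalk_map_nablaTate M),
    isAcyclic_twoTerm (M.nuTate ν) inferInstance⟩

/-- Sequences of F-vector spaces split, and F-linear maps are automatically continuous, so the
splitting is one of Tate spaces. -/
theorem nonempty_splitting_ofLinear (f : E →ₗ[LaurentSeries k] E')
    (g : E' →ₗ[LaurentSeries k] E'') (hf : Function.Injective f) (hfg : Function.Exact f g)
    (hg : Function.Surjective g) :
    Nonempty (ShortComplex.mk (C := ElTate k) (ElTate.ofLinear f) (ElTate.ofLinear g)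
      (congrArg (ElTate.ofLinear (k := k) (E := E) (E' := E'')) hfg.linearMap_comp_eq_zero)).Splitting := by
  obtain ⟨s, hs⟩ := g.exists_rightInverse_of_surjective (LinearMap.range_eq_top.2 hg)
  obtain ⟨r, hr⟩ := f.exists_leftInverse_of_injective (LinearMap.ker_eq_bot.2 hf)
  have hs' : ∀ x, g (s x) = x := LinearMap.congr_fun hs
  have hr' : ∀ x, r (f x) = x := LinearMap.congr_fun hr
  -- An arbitrary left inverse `r` of `f` need not vanish on the image of `s`; composing with the
  -- projector `id - s g` makes it compatible with `s`.
  refine ⟨⟨ElTate.ofLinear (r ∘ₗ (LinearMap.id - s ∘ₗ g)), ElTate.ofLinear s, ?_, ?_, ?_⟩⟩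
  · refine congrArg (ElTate.ofLinear (k := k) (E := E) (E' := E))
      (a₁ := (r ∘ₗ (LinearMap.id - s ∘ₗ g)) ∘ₗ f) (a₂ := LinearMap.id) (LinearMap.ext fun x ↦ ?_)
    change r (f x - s (g (f x))) = x
    rw [hfg.apply_apply_eq_zero, map_zero, sub_zero, hr']
  · exact congrArg (ElTate.ofLinear (k := k) (E := E'') (E' := E'')) hs
  · refine congrArg (ElTate.ofLinear (k := k) (E := E') (E' := E'))
      (a₁ := f ∘ₗ r ∘ₗ (LinearMap.id - s ∘ₗ g) + s ∘ₗ g) (a₂ := LinearMap.id)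
      (LinearMap.ext fun x ↦ ?_)
    change f (r (x - s (g x))) + s (g x) = x
    obtain ⟨y, hy⟩ := (hfg (x - s (g x))).1 (by rw [map_sub, hs', sub_self])
    rw [← hy, hr', hy, sub_add_cancel]

theorem conflations_toCalk_ofLinear (f : E →ₗ[LaurentSeries k] E')
    (g : E' →ₗ[LaurentSeries k] E'') (hf : Function.Injective f) (hfg : Function.Exact f g)
    (hg : Function.Surjective g)
    (w : (ElTate.toCalk k).map (ElTate.ofLinear f) ≫ (ElTate.toCalk k).map (ElTate.ofLinear g) = 0) :
    Calk.conflations k (.mk _ _ w) := by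
  obtain ⟨s⟩ := nonempty_splitting_ofLinear (k := k) f g hf hfg hg
  exact Calk.conflations_of_splitting_of_elTate (s.map (ElTate.toCalk k)) (Iso.refl _) (Iso.refl _)

theorem toCalk_map_ofLinear_add (h f g : E →ₗ[LaurentSeries k] E') (e : h = f + g) :
    (ElTate.toCalk k).map (ElTate.ofLinear h) =
      (ElTate.toCalk k).map (ElTate.ofLinear f) + (ElTate.toCalk k).map (ElTate.ofLinear g) := by
  rw [e, ElTate.ofLinear_add, Functor.map_add]

theorem additive_omega (ν : OneForm k) : (omega ν).Additive where
  map_add {M N} φ ψ := by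
    ext j : 1
    match j with
    | .ofNat 0 => exact toCalk_map_ofLinear_add (φ.toLin + ψ.toLin) φ.toLin ψ.toLin rfl
    | .ofNat 1 =>
      exact toCalk_map_ofLinear_add ((φ.toLin + ψ.toLin).rTensor (OneForm k))
        (φ.toLin.rTensor (OneForm k)) (ψ.toLin.rTensor (OneForm k)) (LinearMap.rTensor_add _ _ _)
    | .ofNat (_ + 2) => exact ElTate.isZero_toCalk_zero.eq_of_src _ _
    | .negSucc _ => exact ElTate.isZero_toCalk_zero.eq_of_src _ _

theorem Calk.conflations_of_isZero {S : ShortComplex (Calk k)} (h₁ : IsZero S.X₁)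
    (h₂ : IsZero S.X₂) (h₃ : IsZero S.X₃) : Calk.conflations k S :=
  Calk.conflations_of_splitting_of_elTate
    ⟨0, 0, h₁.eq_of_src _ _, h₃.eq_of_src _ _, h₂.eq_of_src _ _⟩
    (h₁.iso ElTate.isZero_toCalk_zero) (h₃.iso ElTate.isZero_toCalk_zero)

/-- In degree 1 the sequence stays exact after tensoring with Ω¹, which is flat over the field F.
The morphisms `f`, `g` are kept as variables with equations so that the statement fits the doubly
mapped short complex by unification. -/
theorem conflations_map_omega (ν : OneForm k) {S : ShortComplex (FlatConnection k)}
    (hS : FlatConnection.conflations k S) (f : (omega ν).obj S.X₁ ⟶ (omega ν).obj S.X₂)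
    (g : (omega ν).obj S.X₂ ⟶ (omega ν).obj S.X₃) (hf : f = (omega ν).map S.f)
    (hg : g = (omega ν).map S.g) (j : ℤ) (w : f.f j ≫ g.f j = 0) :
    Calk.conflations k (.mk (f.f j) (g.f j) w) := by
  subst hf hg
  obtain ⟨h₁, h₂, h₃⟩ := hS
  match j, w with
  | .ofNat 0, w => exact conflations_toCalk_ofLinear S.f.toLin S.g.toLin h₁ h₂ h₃ w
  | .ofNat 1, w =>
    exact conflations_toCalk_ofLinear (S.f.toLin.rTensor (OneForm k))
      (S.g.toLin.rTensor (OneForm k)) (Module.Flat.rTensor_preserves_injective_linearMap _ h₁)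
      (rTensor_exact (OneForm k) h₂ h₃) (LinearMap.rTensor_surjective (OneForm k) h₃) w
  | .ofNat (_ + 2), w =>
    exact Calk.conflations_of_isZero ElTate.isZero_toCalk_zero ElTate.isZero_toCalk_zero
      ElTate.isZero_toCalk_zero
  | .negSucc _, w =>
    exact Calk.conflations_of_isZero ElTate.isZero_toCalk_zero ElTate.isZero_toCalk_zero
      ElTate.isZero_toCalk_zero

end Contraction

end EpsilonFactor

theorem lemma2p5 (k : Type u) [Field k] [CharZero k] (ν : EpsilonFactor.OneForm k) (hν : ν ≠ 0) :
    (∀ M : EpsilonFactor.FlatConnection k,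
      ((EpsilonFactor.omega ν).obj M).IsExact (EpsilonFactor.Calk.conflations k)) ∧
    ∃ Φ : EpsilonFactor.FlatConnection k ⥤ EpsilonFactor.BinEx (EpsilonFactor.Calk.conflations k),
      Φ ⋙ EpsilonFactor.BinEx.ι (EpsilonFactor.Calk.conflations k) = EpsilonFactor.omega ν ∧
      EpsilonFactor.IsExactFunctor (EpsilonFactor.FlatConnection.conflations k)
        (EpsilonFactor.BinEx.conflations (EpsilonFactor.Calk.conflations k)) Φ := by
  have h := fun M ↦ EpsilonFactor.isExact_omega_obj (k := k) M hν
  refine ⟨h, ObjectProperty.lift _ (EpsilonFactor.omega ν) h, rfl, ⟨⟨?_⟩, fun S hS j ↦ ?_⟩⟩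
  · intro M N φ ψ
    have := EpsilonFactor.additive_omega ν
    exact ObjectProperty.hom_ext _ ((EpsilonFactor.omega ν).map_add (f := φ) (g := ψ))
  · exact EpsilonFactor.conflations_map_omega ν hS _ _ rfl rfl j _
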